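/- Let $\mathcal A$ be the class of abelian extensions $K/\mathbb Q$ whose conductor (the least $m\ge 1$ such that $K$ embeds in the $m$-th cyclotomic field) is $p^r$ with $p$ an odd prime and $r\ge 1$. For $K\in\mathcal A$ write $p_K=p$, $r_K=r$, let $n=[K:\mathbb Q]$, let $D_K$ be the absolute value of the discriminant of $K$, let $e_K=e=[\mathbb Q(\zeta):K]$ with $\zeta$ a primitive $p^r$-th root of unity, let $$M(K)=\sup_{x\in K}\ \inf_{c\in\mathcal O_K}|N_{K/\mathbb Q}(x-c)|$$ be the Euclidean minimum of $K$, and put $$C(K)=\sqrt{\frac{p^{r+1}+p^r+1-e^2}{12\,p^{r+1}}},\qquad \delta=\frac{p^{r-1}-1}{p^{r-1}(p-1)},\qquad \omega(K)=C(K)\,(\sqrt p)^{\,\delta+\frac1n}.$$ **Theorem.** 1. For every $K\in\mathcal A$, $\;M(K)\le \omega(K)^n\sqrt{D_K}$. 2. $\lim_{p_K\to\infty}\omega(K)=\frac1{2\sqrt3}$ when $K$ runs through the fields in $\mathcal A$ with $r_K\ge 2$; and, for each fixed $e_0$, also when $K$ runs through the fields in $\mathcal A$ with $r_K=1$ and $e_K=e_0$.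 Here, for $\mathcal D\subset\mathcal A$, $\lim_{p_K\to\infty}\omega(K)=\omega_0$ over $\mathcal D$ means that for every $\varepsilon>0$ there is $N>0$ such that $|\omega(K)-\omega_0|<\varepsilon$ for every $K\in\mathcal D$ with $p_K>N$. 3. If $K\in\mathcal A$ and $r_K\ge 2$, then $\omega(K)\le 3^{-2/3}$. -/

import Mathlib

open scoped NumberField ENNReal

universe u

namespace AbelianEuclidean

noncomputable section

/-- The Euclidean minimum `M(K) = sup_{x ∈ K} inf_{c ∈ 𝓞 K} |N(x - c)|`, as an element of `[0, ∞]`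
(so that no boundedness is presupposed). -/
def euclideanMinimum (K : Type u) [Field K] [NumberField K] : ℝ≥0∞ :=
  ⨆ x : K, ⨅ c : 𝓞 K, ENNReal.ofReal |((Algebra.norm ℚ (x - (c : K)) : ℚ) : ℝ)|

/-- The conductor of an abelian number field: the least `m ≥ 1` such that `K` embeds in the `m`-th
cyclotomic field `ℚ(ζ_m)`. (The value is `0` if there is no such `m`.) -/
def conductor (K : Type u) [Field K] : ℕ :=
  sInf {m : ℕ | 0 < m ∧ Nonempty (K →+* CyclotomicField m ℚ)}

/-- The class `𝒜` of abelian extensions of `ℚ` whose conductor is a power `p ^ r`, `r ≥ 1`, of an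
odd prime `p`. -/
structure IsAbelianOddPrimePower (K : Type u) [Field K] [NumberField K] : Prop where
  abelian : IsAbelianGalois ℚ K
  conductor_eq : ∃ p r : ℕ, p.Prime ∧ Odd p ∧ 1 ≤ r ∧ conductor K = p ^ r

/-- The degree `n` of `K` over `ℚ`. -/
def degreeN (K : Type u) [Field K] [NumberField K] : ℕ := Module.finrank ℚ K

/-- The absolute value `D` of the discriminant of `K`. -/
def absDiscr (K : Type u) [Field K] [NumberField K] : ℕ := (NumberField.discr K).natAbs

/-- The prime `p` dividing the conductor of `K` (for `K` in `𝒜` it is the only one). -/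
def primeP (K : Type u) [Field K] [NumberField K] : ℕ := (conductor K).minFac

/-- The exponent `r`, i.e. the `p`-adic valuation of the conductor of `K`. -/
def expR (K : Type u) [Field K] [NumberField K] : ℕ := padicValNat (primeP K) (conductor K)

open Classical in
/-- The degree `e = [ℚ(ζ) : K]`, where `ζ` is a primitive root of unity whose order is the
conductor of `K` and `K` is seen inside `ℚ(ζ)` through an embedding (the degree does not depend on
which one). -/
def codegreeE (K : Type u) [Field K] [NumberField K] : ℕ :=
  if h : Nonempty (K →+* CyclotomicField (conductor K) ℚ) then
    Module.finrank h.some.fieldRange (CyclotomicField (conductor K) ℚ)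
  else 0

/-- `C(K) = √f` with `f = (p^(r+1) + p^r + 1 - e^2) / (12 p^(r+1))`. -/
def constC (K : Type u) [Field K] [NumberField K] : ℝ :=
  Real.sqrt (((primeP K : ℝ) ^ (expR K + 1) + (primeP K : ℝ) ^ (expR K) + 1
    - (codegreeE K : ℝ) ^ 2) / (12 * (primeP K : ℝ) ^ (expR K + 1)))

/-- `δ(K) = (p^(r-1) - 1) / (p^(r-1) (p - 1))`. -/
def constDelta (K : Type u) [Field K] [NumberField K] : ℝ :=
  ((primeP K : ℝ) ^ (expR K - 1) - 1) / ((primeP K : ℝ) ^ (expR K - 1) * ((primeP K : ℝ) - 1))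

/-- `ω(K) = C(K) (√p)^(δ + 1/n)`. -/
def omega (K : Type u) [Field K] [NumberField K] : ℝ :=
  constC K * Real.sqrt (primeP K : ℝ) ^ (constDelta K + 1 / (degreeN K : ℝ))

/-- `lim_{p_K → ∞} ψ(K) = l`, where `K` runs through the fields of `𝒜` that belong to `D`. -/
def HasLimitAsP (D : ∀ (K : Type u) [Field K] [NumberField K], Prop)
    (ψ : ∀ (K : Type u) [Field K] [NumberField K], ℝ) (l : ℝ) : Prop :=
  ∀ ε : ℝ, 0 < ε → ∃ N : ℝ, 0 < N ∧
    ∀ (K : Type u) [Field K] [NumberField K], IsAbelianOddPrimePower K → D K →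
      N < (primeP K : ℝ) → |ψ K - l| < ε

end

end AbelianEuclidean

/-! Let `L = ℚ(ζ)` have conductor `p ^ (k + 1)`, with `r = k + 1`. Minimality of the conductor
forces `p ∤ e = [L : K]` (`nonempty_ringHom_of_dvd_finrank`). Hence every nontrivial automorphism of
`L/K` is `ζ ↦ ζ ^ u` with `u - 1` a unit modulo `p ^ (k + 1)` (`isUnit_autToPow_sub_one`). This fact
serves twice.

Covering. In coordinates along all powers of `ζ`, the form `Tr (z * conj z)` splits into `p ^ k`
pieces, one for each class modulo `p ^ k`, each a multiple of `p ∑ v² - (∑ v)²`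
(`sum_embeddings_norm_sq`). An element of `K` has Galois-invariant coordinates. In each piece they
are rounded with a common threshold; averaging over the threshold shows that a good one exists, and
coinciding coordinates improve the bound (`exists_thresholdRound_sum_le`). Over the class `0` the
Galois orbits of nonzero residues have size `e`, whence the `-e²` in `C(K)`. Equivariant rounding
(`exists_invariant_round`) lands in `𝓞 K`, and the AM-GM inequality turns the trace bound into a
norm bound.

Discriminant. The different of `L/K` divides `(1 - ζ) ^ (e - 1)`, so `D_L ≤ p ^ (e - 1) * D_K ^ e`
(`natAbs_discr_le_of_tame`). As `D_L` is known explicitly, this gives the first assertion.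

For the other two, `δ + 1/n = (p ^ (r - 1) - 1 + e) / (p ^ (r - 1) * (p - 1))` is `O(1/p)`, since `e
≤ p - 1` when `r ≥ 2` and `e` is fixed when `r = 1`. So `ω(K)` lies between `1 / (2√3)` and an
explicit function of `p`. -/

namespace AbelianEuclidean

noncomputable section

/-! ### Threshold rounding and the covering bound for one fibre -/

/-- The integer next to `x` obtained by rounding down, and by one more when the fractional part of
`x` lies below the threshold `t`. -/
def thresholdRound (t x : ℝ) : ℤ := ⌊x⌋ - if Int.fract x < t then 1 else 0

lemma sub_thresholdRound (t x : ℝ) :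
    x - thresholdRound t x = Int.fract x + if Int.fract x < t then 1 else 0 := by
  unfold thresholdRound
  rw [← Int.self_sub_floor]
  split_ifs <;> push_cast <;> ring

/-- The difference changes from `a - b` to `1 + a - b` exactly for `t` in `(a, b]`, an interval of
length `b - a`. -/
lemma integral_sq_shift_sub_of_le {a b : ℝ} (ha : 0 ≤ a) (hab : a ≤ b) (hb : b ≤ 1) :
    ∫ t in (0 : ℝ)..1, ((a + if a < t then 1 else 0) - (b + if b < t then 1 else 0)) ^ 2 =
      |a - b| - (a - b) ^ 2 := by
  have h : ∀ t : ℝ, ((a + if a < t then (1 : ℝ) else 0) - (b + if b < t then 1 else 0)) ^ 2 =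
      (a - b) ^ 2 + (Set.Ioc a b).indicator (fun _ => 1 - 2 * (b - a)) t := by
    intro t
    by_cases h1 : a < t <;> by_cases h2 : b < t
    · simp [h1, h2, not_le.2 h2]
    · simp [h1, h2, not_lt.1 h2]; ring
    · linarith
    · simp [h1, h2]
  simp_rw [h]
  have hi : IntervalIntegrable ((Set.Ioc a b).indicator (fun _ => 1 - 2 * (b - a)))
      MeasureTheory.volume 0 1 := by
    rw [intervalIntegrable_iff, Set.uIoc_of_le zero_le_one]
    exact (MeasureTheory.integrable_const _).indicator measurableSet_Ioc
  rw [intervalIntegral.integral_add (by simp) hi, intervalIntegral.integral_of_le zero_le_one,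
    intervalIntegral.integral_of_le zero_le_one,
    MeasureTheory.setIntegral_indicator measurableSet_Ioc,
    Set.inter_eq_self_of_subset_right (Set.Ioc_subset_Ioc ha hb)]
  simp only [MeasureTheory.integral_const, MeasureTheory.measureReal_restrict_apply_univ,
    Real.volume_real_Ioc, smul_eq_mul]
  rw [abs_of_nonpos (by linarith), max_eq_left (by linarith), max_eq_left (by linarith)]
  ring

lemma integral_sq_shift_sub {a b : ℝ} (ha : 0 ≤ a) (ha' : a ≤ 1) (hb : 0 ≤ b) (hb' : b ≤ 1) :
    ∫ t in (0 : ℝ)..1, ((a + if a < t then 1 else 0) - (b + if b < t then 1 else 0)) ^ 2 =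
      |a - b| - (a - b) ^ 2 := by
  rcases le_total a b with h | h
  · exact integral_sq_shift_sub_of_le ha h hb'
  · rw [abs_sub_comm, sub_sq_comm, ← integral_sq_shift_sub_of_le hb h ha']
    simp_rw [sub_sq_comm (b + _)]

/-- Among three distinct reals the two extremes contribute `1` and the median `-1`; if exactly two
agree, only the third contributes. -/
lemma sign_triple (a b c : ℝ) :
    (SignType.sign (a - b) * SignType.sign (a - c) + SignType.sign (b - a) * SignType.sign (b - c)
      + SignType.sign (c - a) * SignType.sign (c - b) : ℝ) = 1 - if b = a ∧ c = a then 1 else 0 := by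
  rcases lt_trichotomy a b with h1 | rfl | h1 <;> rcases lt_trichotomy a c with h2 | rfl | h2
  · rcases lt_trichotomy b c with h3 | rfl | h3 <;>
      simp [sign_apply, *, ne_of_gt]
  · simp [sign_apply, *, ne_of_gt]
  · simp [*, ne_of_gt, h2.trans h1]
  · simp [sign_apply, *, ne_of_gt]
  · simp
  · simp [sign_apply, *, ne_of_lt]
  · simp [*, ne_of_lt, h1.trans h2]
  · simp [sign_apply, *, ne_of_lt]
  · rcases lt_trichotomy b c with h3 | rfl | h3 <;>
      simp [sign_apply, *, ne_of_lt]

section Rounding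

variable {α : Type*} [Fintype α]

-- Expanding the square gives a sum over triples; symmetrising it in the three indices leaves one
-- third of the number of triples that are not constant under `y`.
open Classical in
lemma sum_sq_sum_sign (y : α → ℝ) :
    ∑ a, (∑ b, (SignType.sign (y a - y b) : ℝ)) ^ 2 =
      ((Fintype.card α : ℝ) ^ 3 -
        ∑ a, ((Finset.univ.filter fun b => y b = y a).card : ℝ) ^ 2) / 3 := by
  have h0 : ∑ a, (∑ b, (SignType.sign (y a - y b) : ℝ)) ^ 2 =
      ∑ a, ∑ b, ∑ c, (SignType.sign (y a - y b) * SignType.sign (y a - y c) : ℝ) := by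
    refine Finset.sum_congr rfl fun a _ => ?_
    rw [sq, Finset.sum_mul_sum]
  have h1 : ∑ a, ∑ b, ∑ c, (SignType.sign (y a - y b) * SignType.sign (y a - y c) : ℝ) =
      ∑ a, ∑ b, ∑ c, (SignType.sign (y b - y a) * SignType.sign (y b - y c) : ℝ) :=
    Finset.sum_comm
  have h2 : ∑ a, ∑ b, ∑ c, (SignType.sign (y a - y b) * SignType.sign (y a - y c) : ℝ) =
      ∑ a, ∑ b, ∑ c, (SignType.sign (y c - y a) * SignType.sign (y c - y b) : ℝ) :=
    Finset.sum_comm.trans (Finset.sum_congr rfl fun _ _ => Finset.sum_comm)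
  have h3 : ∑ a, ((Finset.univ.filter fun b => y b = y a).card : ℝ) ^ 2 =
      ∑ a, ∑ b, ∑ c, if y b = y a ∧ y c = y a then (1 : ℝ) else 0 := by
    refine Finset.sum_congr rfl fun a _ => ?_
    rw [Finset.card_filter]
    push_cast
    rw [sq, Finset.sum_mul_sum]
    refine Finset.sum_congr rfl fun b _ => Finset.sum_congr rfl fun c _ => ?_
    split_ifs <;> simp_all
  have h4 : ∑ a, ∑ b, ∑ c, (SignType.sign (y a - y b) * SignType.sign (y a - y c)
      + SignType.sign (y b - y a) * SignType.sign (y b - y c)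
      + SignType.sign (y c - y a) * SignType.sign (y c - y b) : ℝ) =
      ∑ a : α, ∑ b : α, ∑ c : α, ((1 : ℝ) - if y b = y a ∧ y c = y a then (1 : ℝ) else 0) := by
    simp_rw [sign_triple]
  simp only [Finset.sum_add_distrib, Finset.sum_sub_distrib] at h4
  rw [← h1, ← h2, ← h3] at h4
  simp only [Finset.sum_const, Finset.card_univ, nsmul_eq_mul, mul_one] at h4
  rw [h0]
  linarith

lemma sum_sum_sub_sq (v : α → ℝ) :
    ∑ a, ∑ b, (v a - v b) ^ 2 =
      2 * (Fintype.card α * ∑ a, v a ^ 2 - (∑ a, v a) ^ 2) := by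
  have h : ∀ a b, (v a - v b) ^ 2 = v a ^ 2 + v b ^ 2 - 2 * (v a * v b) := fun a b => by ring
  simp_rw [h, Finset.sum_sub_distrib, Finset.sum_add_distrib, ← Finset.mul_sum,
    ← Finset.sum_mul]
  simp only [Finset.sum_const, Finset.card_univ, nsmul_eq_mul, ← Finset.mul_sum]
  ring

lemma sum_sum_abs_sub (y : α → ℝ) :
    ∑ a, ∑ b, |y a - y b| = 2 * ∑ a, y a * ∑ b, (SignType.sign (y a - y b) : ℝ) := by
  have h : ∀ a b, |y a - y b| = y a * (SignType.sign (y a - y b) : ℝ) +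
      y b * (SignType.sign (y b - y a) : ℝ) := by
    intro a b
    rw [← neg_sub (y a) (y b), Left.sign_neg, ← self_mul_sign]
    push_cast
    ring
  simp_rw [h, Finset.sum_add_distrib]
  rw [Finset.sum_comm (f := fun a b => y b * (SignType.sign (y b - y a) : ℝ)), two_mul]
  simp_rw [Finset.mul_sum]

lemma sum_sum_sign (y : α → ℝ) : ∑ a, ∑ b, (SignType.sign (y a - y b) : ℝ) = 0 := by
  have h : ∑ a, ∑ b, (SignType.sign (y a - y b) : ℝ) =
      -∑ a, ∑ b, (SignType.sign (y a - y b) : ℝ) := by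
    conv_lhs => rw [Finset.sum_comm]
    simp_rw [← Finset.sum_neg_distrib]
    refine Finset.sum_congr rfl fun a _ => Finset.sum_congr rfl fun b _ => ?_
    rw [← neg_sub, Left.sign_neg]
    simp
  linarith

/-- Completing the square: with `s a` the sign sum, Cauchy-Schwarz is applied to `y - s / (2N)`,
whose total equals that of `y` because the `s a` add up to zero. -/
lemma sum_sum_abs_sub_sub_sq_le [Nonempty α] (y : α → ℝ) :
    ∑ a, ∑ b, (|y a - y b| - (y a - y b) ^ 2) ≤
      (∑ a, (∑ b, (SignType.sign (y a - y b) : ℝ)) ^ 2) / (2 * Fintype.card α) := by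
  set s : α → ℝ := fun a => ∑ b, (SignType.sign (y a - y b) : ℝ) with hs
  have hN : (0 : ℝ) < Fintype.card α := by exact_mod_cast Fintype.card_pos
  have hs0 : ∑ a, s a = 0 := sum_sum_sign y
  simp only [Finset.sum_sub_distrib]
  rw [sum_sum_abs_sub, sum_sum_sub_sq]
  set N : ℝ := (Fintype.card α : ℝ)
  have hc : (∑ a, (y a - s a / (2 * N))) ^ 2 ≤ N * ∑ a, (y a - s a / (2 * N)) ^ 2 := by
    simpa using sq_sum_le_card_mul_sum_sq (s := Finset.univ) (f := fun a => y a - s a / (2 * N))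
  have e1 : ∑ a, (y a - s a / (2 * N)) = ∑ a, y a := by
    rw [Finset.sum_sub_distrib, ← Finset.sum_div, hs0]; simp
  have e2 : N * ∑ a, (y a - s a / (2 * N)) ^ 2 =
      N * ∑ a, y a ^ 2 - ∑ a, y a * s a + (∑ a, s a ^ 2) / (4 * N) := by
    rw [Finset.mul_sum, Finset.mul_sum, Finset.sum_div, ← Finset.sum_sub_distrib,
      ← Finset.sum_add_distrib]
    refine Finset.sum_congr rfl fun a _ => ?_
    field_simp
    ring
  rw [e1, e2] at hc
  have e3 : (∑ a, s a ^ 2) / (2 * N) = 2 * ((∑ a, s a ^ 2) / (4 * N)) := by field_simp; ring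
  change 2 * ∑ a, y a * s a - _ ≤ (∑ a, s a ^ 2) / (2 * N)
  rw [e3]
  linarith

open Classical in
/-- Covering bound for the projection of `ℤ^α` orthogonally to `(1, …, 1)`, refined at points whose
coordinates take few values. -/
theorem exists_thresholdRound_sum_le [Nonempty α] (x : α → ℝ) :
    ∃ t : ℝ, Fintype.card α * ∑ a, (x a - thresholdRound t (x a)) ^ 2 -
      (∑ a, (x a - thresholdRound t (x a))) ^ 2 ≤
      (Fintype.card α : ℝ) ^ 2 / 12 -
        (∑ a, ((Finset.univ.filter fun b => x b = x a).card : ℝ) ^ 2) /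
          (12 * Fintype.card α) := by
  set y : α → ℝ := fun a => Int.fract (x a)
  have hN : (0 : ℝ) < Fintype.card α := by exact_mod_cast Fintype.card_pos
  have hI : ∀ a b, MeasureTheory.IntegrableOn (fun t : ℝ =>
      ((y a + if y a < t then (1 : ℝ) else 0) - (y b + if y b < t then 1 else 0)) ^ 2)
      (Set.Ioc 0 1) := by
    intro a b
    refine MeasureTheory.Measure.integrableOn_of_bounded (M := 16) (by simp) ?_ ?_
    · have : ∀ c : ℝ, Measurable fun t : ℝ => if c < t then (1 : ℝ) else 0 := fun c =>
        Measurable.ite measurableSet_Ioi measurable_const measurable_const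
      have h1 := this (y a)
      have h2 := this (y b)
      exact (((h1.const_add _).sub (h2.const_add _)).pow_const 2).aestronglyMeasurable
    · refine Filter.Eventually.of_forall fun t => ?_
      have h1 := Int.fract_nonneg (x a)
      have h2 := (Int.fract_lt_one (x a)).le
      have h3 := Int.fract_nonneg (x b)
      have h4 := (Int.fract_lt_one (x b)).le
      rw [Real.norm_of_nonneg (sq_nonneg _)]
      rw [show (16 : ℝ) = 4 ^ 2 by norm_num]
      apply sq_le_sq'
      · split_ifs <;> simp only [y] <;> linarith
      · split_ifs <;> simp only [y] <;> linarith
  -- Some threshold does at least as well as the average over `(0, 1]`.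
  obtain ⟨t, -, ht⟩ := MeasureTheory.exists_le_setAverage
    (μ := MeasureTheory.volume) (s := Set.Ioc (0 : ℝ) 1)
    (f := fun t => ∑ a, ∑ b, ((y a + if y a < t then (1 : ℝ) else 0) -
      (y b + if y b < t then 1 else 0)) ^ 2) (by simp) (by simp)
    (MeasureTheory.integrable_finsetSum _ fun a _ =>
      MeasureTheory.integrable_finsetSum _ fun b _ => hI a b)
  refine ⟨t, ?_⟩
  rw [MeasureTheory.setAverage_eq] at ht
  rw [MeasureTheory.integral_finsetSum _ fun a _ =>
      MeasureTheory.integrable_finsetSum _ fun b _ => hI a b] at ht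
  simp_rw [MeasureTheory.integral_finsetSum _ fun b _ => hI _ b,
    ← intervalIntegral.integral_of_le (zero_le_one (α := ℝ))] at ht
  have hi : ∀ a b, ∫ t in (0 : ℝ)..1, ((y a + if y a < t then (1 : ℝ) else 0) -
      (y b + if y b < t then 1 else 0)) ^ 2 = |y a - y b| - (y a - y b) ^ 2 := fun a b =>
    integral_sq_shift_sub (Int.fract_nonneg _) (Int.fract_lt_one _).le (Int.fract_nonneg _)
      (Int.fract_lt_one _).le
  simp_rw [hi] at ht
  simp only [Real.volume_real_Ioc, sub_zero, zero_le_one, sup_of_le_left, inv_one, one_smul] at ht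
  have hb := ht.trans (sum_sum_abs_sub_sub_sq_le y)
  rw [sum_sum_sub_sq, sum_sq_sum_sign] at hb
  -- Passing to fractional parts can only create more coincidences, which helps.
  have hm : ∑ a, ((Finset.univ.filter fun b => x b = x a).card : ℝ) ^ 2 ≤
      ∑ a, ((Finset.univ.filter fun b => y b = y a).card : ℝ) ^ 2 := by
    refine Finset.sum_le_sum fun a _ => ?_
    have : (Finset.univ.filter fun b => x b = x a).card ≤
        (Finset.univ.filter fun b => y b = y a).card :=
      Finset.card_le_card (Finset.monotone_filter_right _ fun b _ h => by simp only [y, h])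
    gcongr
  simp_rw [sub_thresholdRound]
  set N : ℝ := (Fintype.card α : ℝ)
  calc _ ≤ (N ^ 3 - ∑ a, ((Finset.univ.filter fun b => y b = y a).card : ℝ) ^ 2) / 3 /
        (2 * N) / 2 := by linarith
    _ ≤ (N ^ 3 - ∑ a, ((Finset.univ.filter fun b => x b = x a).card : ℝ) ^ 2) / 3 /
        (2 * N) / 2 := by gcongr
    _ = _ := by field_simp; ring

end Rounding

/-! ### Units modulo a prime power -/

/-- Modulo a power of an odd prime `p`, a `p`-torsion unit is `1` modulo the preceding power. -/
lemma ZMod_sub_one_dvd_of_pow_eq_one {p k : ℕ} (hp : p.Prime) (hodd : Odd p)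
    {u : ZMod (p ^ (k + 1))} (hu : u ^ p = 1) : (p ^ k : ZMod (p ^ (k + 1))) ∣ u - 1 := by
  have : NeZero (p ^ (k + 1)) := ⟨pow_ne_zero _ hp.ne_zero⟩
  obtain ⟨a, rfl⟩ := ZMod.intCast_surjective u
  have h1 : ((p ^ (k + 1) : ℕ) : ℤ) ∣ a ^ p - 1 ^ p := by
    rw [← ZMod.intCast_zmod_eq_zero_iff_dvd]
    push_cast
    rw [hu]; simp
  have hpd : (p : ℤ) ∣ a - 1 := by
    have := Fact.mk hp
    have h2 : (p : ℤ) ∣ a ^ p - 1 ^ p := (by simp [pow_succ] : (p : ℤ) ∣ (p ^ (k + 1) : ℕ)).trans h1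
    rw [← ZMod.intCast_zmod_eq_zero_iff_dvd] at h2 ⊢
    push_cast at h2 ⊢
    rwa [ZMod.pow_card, one_pow] at h2
  have hpa : ¬ (p : ℤ) ∣ a := by
    intro h
    have h3 := dvd_sub h hpd
    rw [sub_sub_cancel] at h3
    exact hp.one_lt.ne' (by exact_mod_cast Int.eq_one_of_dvd_one (by positivity) h3)
  -- Lifting the exponent: `a ^ p - 1` has exactly one more factor `p` than `a - 1`. This is where
  -- `p` must be odd.
  have hm := Int.emultiplicity_pow_sub_pow hp hodd hpd hpa p
  have h4 : ((k + 1 : ℕ) : ℕ∞) ≤ emultiplicity (p : ℤ) (a ^ p - 1 ^ p) := by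
    apply le_emultiplicity_of_pow_dvd
    exact_mod_cast h1
  rw [hm, (Nat.finiteMultiplicity_iff.2 ⟨hp.ne_one, hp.pos⟩).emultiplicity_self] at h4
  have h5 : (k : ℕ∞) ≤ emultiplicity (p : ℤ) (a - 1) := by
    push_cast at h4
    exact (ENat.add_le_add_iff_right (by simp)).1 h4
  obtain ⟨c, hc⟩ := pow_dvd_of_le_emultiplicity h5
  refine ⟨(c : ZMod (p ^ (k + 1))), ?_⟩
  have := congrArg (Int.cast : ℤ → ZMod (p ^ (k + 1))) hc
  push_cast at this
  exact this

/-- In a group of units modulo `p ^ (k + 1)`, elements congruent to `1` modulo `p` have order a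
power of `p`. -/
lemma pow_prime_pow_eq_one {p k : ℕ} {u : ZMod (p ^ (k + 1))}
    (hu : (p : ZMod (p ^ (k + 1))) ∣ u - 1) : u ^ p ^ k = 1 := by
  have h : ∀ j : ℕ, (p : ZMod (p ^ (k + 1))) ^ (j + 1) ∣ u ^ p ^ j - 1 := by
    intro j
    simpa using dvd_sub_pow_of_dvd_sub (p := p) hu j
  have h1 := h k
  rw [← Nat.cast_pow, ZMod.natCast_self, zero_dvd_iff, sub_eq_zero] at h1
  exact h1

lemma isUnit_of_not_prime_dvd {p k : ℕ} (hp : p.Prime) {u : ZMod (p ^ (k + 1))}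
    (hu : ¬ (p : ZMod (p ^ (k + 1))) ∣ u) : IsUnit u := by
  have : NeZero (p ^ (k + 1)) := ⟨pow_ne_zero _ hp.ne_zero⟩
  obtain ⟨a, rfl⟩ := ZMod.natCast_zmod_surjective u
  rw [ZMod.isUnit_iff_coprime]
  refine Nat.Coprime.pow_right _ ((hp.coprime_iff_not_dvd.2 fun ⟨c, hc⟩ => hu ⟨c, ?_⟩).symm)
  rw [hc]; push_cast; rfl

/-! ### The Galois group of the cyclotomic field over `K` -/

section Galois

variable {K L : Type*} [Field K] [NumberField K] [Field L] [NumberField L] [Algebra K L]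

lemma isCyclotomicExtension_of_tower (n : ℕ) [NeZero n] [IsCyclotomicExtension {n} ℚ L] :
    IsCyclotomicExtension {n} K L := by
  rw [IsCyclotomicExtension.iff_singleton]
  refine ⟨IsCyclotomicExtension.exists_isPrimitiveRoot ℚ L (Set.mem_singleton n) (NeZero.ne n), ?_⟩
  intro x
  have h := ((IsCyclotomicExtension.iff_singleton n ℚ L).1 inferInstance).2 x
  induction h using Algebra.adjoin_induction with
  | mem y hy => exact Algebra.subset_adjoin hy
  | algebraMap q =>
    rw [IsScalarTower.algebraMap_apply ℚ K L]
    exact Subalgebra.algebraMap_mem _ _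
  | add x y _ _ hx hy => exact add_mem hx hy
  | mul x y _ _ hx hy => exact mul_mem hx hy

variable {p k : ℕ} [hp : Fact p.Prime]

/-- If `p` divides the degree of `ℚ(ζ_{p ^ (k + 1)})` over `K` then `K` embeds in
`ℚ(ζ_{p ^ k})`. -/
lemma nonempty_ringHom_of_dvd_finrank [IsCyclotomicExtension {p ^ (k + 1)} ℚ L]
    (hodd : Odd p) (hdvd : p ∣ Module.finrank K L) :
    Nonempty (K →+* CyclotomicField (p ^ k) ℚ) := by
  have := isCyclotomicExtension_of_tower (K := K) (L := L) (p ^ (k + 1))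
  have : IsGalois ℚ L := IsCyclotomicExtension.isGalois {p ^ (k + 1)} ℚ L
  have : IsGalois K L := IsCyclotomicExtension.isGalois {p ^ (k + 1)} K L
  obtain ⟨ζ, hζ⟩ := IsCyclotomicExtension.exists_isPrimitiveRoot ℚ L
    (Set.mem_singleton (p ^ (k + 1))) (NeZero.ne _)
  rw [← IsGalois.card_aut_eq_finrank] at hdvd
  -- Cauchy's theorem gives `h` of order `p`. Its exponent is `1` modulo `p ^ k`, so `h` fixes `ζ ^
  -- p`; by degrees its fixed field, which contains `K`, is `ℚ(ζ ^ p)`.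
  obtain ⟨h, hh⟩ := exists_prime_orderOf_dvd_card' p hdvd
  set h' : L ≃ₐ[ℚ] L := h.restrictScalars ℚ with hh'
  have ho : orderOf h' = p := by
    rw [← hh]
    exact orderOf_injective (AlgEquiv.restrictScalarsHom ℚ) (AlgEquiv.restrictScalars_injective ℚ) h
  have hu : ((hζ.autToPow ℚ h' : ZMod (p ^ (k + 1)))) ^ p = 1 := by
    have h1 : h' ^ p = 1 := orderOf_dvd_iff_pow_eq_one.1 ho.dvd
    rw [← Units.val_pow_eq_pow_val, ← map_pow, h1]; simp
  have hfix : h' (ζ ^ p) = ζ ^ p := by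
    obtain ⟨c, hc⟩ := ZMod_sub_one_dvd_of_pow_eq_one hp.out hodd hu
    rw [map_pow, ← hζ.autToPow_spec ℚ h', ← pow_mul]
    rw [← AddChar.zmodChar_apply' hζ.pow_eq_one, ← AddChar.zmodChar_apply' hζ.pow_eq_one]
    congr 1
    push_cast
    rw [ZMod.natCast_zmod_val, ← sub_eq_zero, show ∀ x y : ZMod (p ^ (k + 1)), x * y - y =
      y * (x - 1) from fun x y => by ring, hc, ← mul_assoc, ← pow_succ', ← Nat.cast_pow,
      ZMod.natCast_self, zero_mul]
  have hζp : IsPrimitiveRoot (ζ ^ p) (p ^ k) := hζ.pow (NeZero.pos _) (pow_succ' p k)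
  have : IsCyclotomicExtension {p ^ k} ℚ (IntermediateField.adjoin ℚ {ζ ^ p}) :=
    hζp.intermediateField_adjoin_isCyclotomicExtension ℚ
  set F := IntermediateField.fixedField (Subgroup.zpowers h') with hF
  have hle : IntermediateField.adjoin ℚ {ζ ^ p} ≤ F := by
    rw [IntermediateField.adjoin_simple_le_iff, hF, IntermediateField.mem_fixedField_iff]
    intro f hf
    have : Subgroup.zpowers h' ≤ MulAction.stabilizer (L ≃ₐ[ℚ] L) (ζ ^ p) := by
      rw [Subgroup.zpowers_le]; exact hfix
    exact this hf
  have hd1 : Module.finrank ℚ (IntermediateField.adjoin ℚ {ζ ^ p}) = (p ^ k).totient :=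
    IsCyclotomicExtension.finrank _ (Polynomial.cyclotomic.irreducible_rat (NeZero.pos _))
  have hd2 : Module.finrank ℚ L = (p ^ (k + 1)).totient :=
    IsCyclotomicExtension.finrank _ (Polynomial.cyclotomic.irreducible_rat (NeZero.pos _))
  have hd3 : Module.finrank ℚ F * p = Module.finrank ℚ L := by
    rw [← Module.finrank_mul_finrank ℚ F L, IntermediateField.finrank_fixedField_eq_card,
      Nat.card_zpowers, ho]
  have hd4 : Module.finrank ℚ F = (p ^ k).totient := by
    rw [hd2] at hd3
    -- For `k = 0` the degree `p - 1` would be divisible by `p`.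
    rcases Nat.eq_zero_or_pos k with rfl | hk
    · exfalso
      rw [zero_add, pow_one, Nat.totient_prime hp.out] at hd3
      have h2 := hp.out.two_le
      have := Nat.le_of_dvd (by omega) (Dvd.intro_left _ hd3)
      omega
    · obtain ⟨j, rfl⟩ : ∃ j, k = j + 1 := ⟨k - 1, by omega⟩
      rw [Nat.totient_prime_pow_succ hp.out] at hd3 ⊢
      exact Nat.eq_of_mul_eq_mul_right hp.out.pos (by rw [hd3, pow_succ]; ring)
  have : IsCyclotomicExtension {p ^ k} ℚ (CyclotomicField (p ^ k) ℚ) :=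
    CyclotomicField.isCyclotomicExtension (p ^ k) ℚ
  have heq := IntermediateField.eq_of_le_of_finrank_eq hle (hd1.trans hd4.symm)
  have hKF : ∀ x : K, algebraMap K L x ∈ F := by
    intro x
    rw [hF, IntermediateField.mem_fixedField_iff]
    intro f hf
    have : Subgroup.zpowers h' ≤ MulAction.stabilizer (L ≃ₐ[ℚ] L) (algebraMap K L x) := by
      rw [Subgroup.zpowers_le]; exact h.commutes x
    exact this hf
  rw [← heq] at hKF
  exact ⟨((IsCyclotomicExtension.algEquiv {p ^ k} ℚ (IntermediateField.adjoin ℚ {ζ ^ p})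
    (CyclotomicField (p ^ k) ℚ)).toRingEquiv.toRingHom).comp
      ((algebraMap K L).codRestrict (IntermediateField.adjoin ℚ {ζ ^ p}) hKF)⟩

/-- If `p` does not divide the degree of `ℚ(ζ_{p ^ (k + 1)})` over `K`, the exponents of the
nontrivial automorphisms over `K` are not congruent to `1` modulo `p`. -/
lemma isUnit_autToPow_sub_one [IsCyclotomicExtension {p ^ (k + 1)} ℚ L]
    {ζ : L} (hζ : IsPrimitiveRoot ζ (p ^ (k + 1)))
    (hdvd : ¬ p ∣ Module.finrank K L) {h : L ≃ₐ[K] L} (hh : h ≠ 1) :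
    IsUnit ((hζ.autToPow K h : ZMod (p ^ (k + 1))) - 1) := by
  have := isCyclotomicExtension_of_tower (K := K) (L := L) (p ^ (k + 1))
  have : IsGalois K L := IsCyclotomicExtension.isGalois {p ^ (k + 1)} K L
  by_contra hu
  have h1 : (p : ZMod (p ^ (k + 1))) ∣ (hζ.autToPow K h : ZMod (p ^ (k + 1))) - 1 := by
    by_contra h2
    exact hu (isUnit_of_not_prime_dvd hp.out h2)
  have h2 := pow_prime_pow_eq_one h1
  have h3 : h ^ p ^ k = 1 := by
    apply hζ.autToPow_injective K
    rw [map_pow, map_one, ← Units.val_inj]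
    simpa using h2
  have h4 : orderOf h ∣ p ^ k := orderOf_dvd_of_pow_eq_one h3
  have h5 : orderOf h ∣ Module.finrank K L := by
    rw [← IsGalois.card_aut_eq_finrank]; exact orderOf_dvd_natCard h
  have h6 : (p ^ k).Coprime (Module.finrank K L) :=
    Nat.Coprime.pow_left _ (hp.out.coprime_iff_not_dvd.2 hdvd)
  exact hh (orderOf_eq_one_iff.1 (Nat.eq_one_of_dvd_coprimes h6 h4 h5))

variable (K L p k) in
lemma finrank_mul_finrank_of_cyclotomic [IsCyclotomicExtension {p ^ (k + 1)} ℚ L] :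
    Module.finrank ℚ K * Module.finrank K L = p ^ k * (p - 1) := by
  rw [Module.finrank_mul_finrank, IsCyclotomicExtension.finrank (n := p ^ (k + 1)) L
    (Polynomial.cyclotomic.irreducible_rat (NeZero.pos _)), Nat.totient_prime_pow_succ hp.out]

variable (k) in
lemma finrank_dvd_sub_one [IsCyclotomicExtension {p ^ (k + 1)} ℚ L]
    (hdvd : ¬ p ∣ Module.finrank K L) : Module.finrank K L ∣ p - 1 := by
  have h6 : (Module.finrank K L).Coprime (p ^ k) :=
    (Nat.Coprime.pow_left _ (hp.out.coprime_iff_not_dvd.2 hdvd)).symm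
  exact h6.dvd_of_dvd_mul_left
    (Dvd.intro_left _ (finrank_mul_finrank_of_cyclotomic K L p k))

end Galois

/-! ### Equivariant rounding on residues modulo `p ^ (k + 1)` -/

section Combinatorics

open Classical in
lemma exists_thresholdRound_finset_sum_le {α : Type*} {s : Finset α} (hs : s.Nonempty)
    (x : α → ℝ) :
    ∃ t : ℝ, s.card * ∑ a ∈ s, (x a - thresholdRound t (x a)) ^ 2 -
      (∑ a ∈ s, (x a - thresholdRound t (x a))) ^ 2 ≤
      (s.card : ℝ) ^ 2 / 12 -
        (∑ a ∈ s, ((s.filter fun b => x b = x a).card : ℝ) ^ 2) / (12 * s.card) := by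
  have : Nonempty s := hs.to_subtype
  obtain ⟨t, ht⟩ := exists_thresholdRound_sum_le fun a : s => x a
  refine ⟨t, ?_⟩
  have hcard : ∀ a, (Finset.univ.filter fun b : s => x b = x a).card =
      (s.filter fun b => x b = x a).card := by
    intro a
    rw [Finset.card_filter, Finset.card_filter,
      Finset.sum_coe_sort s fun b => if x b = x a then 1 else 0]
  simp only [hcard] at ht
  rw [Finset.sum_coe_sort s fun a => (x a - thresholdRound t (x a)) ^ 2,
    Finset.sum_coe_sort s fun a => (x a - (thresholdRound t (x a) : ℝ)),
    Finset.sum_coe_sort s fun a => ((s.filter fun b => x b = x a).card : ℝ) ^ 2,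
    Fintype.card_coe] at ht
  exact ht

variable {p k : ℕ} [hp : Fact p.Prime]

/-- Reduction from `ℤ / p ^ (k + 1)` to `ℤ / p ^ k`. -/
def zmodRed (p k : ℕ) : ZMod (p ^ (k + 1)) →+* ZMod (p ^ k) :=
  ZMod.castHom (pow_dvd_pow p k.le_succ) (ZMod (p ^ k))

lemma zmodRed_surjective (p k : ℕ) : Function.Surjective (zmodRed p k) :=
  ZMod.castHom_surjective _

/-- The residue classes modulo `p ^ (k + 1)` above a class modulo `p ^ k`. -/
def redFiber (b : ZMod (p ^ k)) : Finset (ZMod (p ^ (k + 1))) :=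
  Finset.univ.filter fun a => zmodRed p k a = b

@[simp] lemma mem_redFiber {b : ZMod (p ^ k)} {a : ZMod (p ^ (k + 1))} :
    a ∈ redFiber b ↔ zmodRed p k a = b := by simp [redFiber]

lemma sum_redFiber {R : Type*} [AddCommMonoid R] (F : ZMod (p ^ (k + 1)) → R) :
    ∑ b : ZMod (p ^ k), ∑ a ∈ redFiber b, F a = ∑ a, F a :=
  Finset.sum_fiberwise _ _ _

lemma sum_redFiber_unit_mul {R : Type*} [AddCommMonoid R] {F : ZMod (p ^ (k + 1)) → R}
    (u : (ZMod (p ^ (k + 1)))ˣ) (hF : ∀ a, F (u * a) = F a) (b : ZMod (p ^ k)) :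
    ∑ a ∈ redFiber (zmodRed p k u * b), F a = ∑ a ∈ redFiber b, F a := by
  symm
  refine Finset.sum_equiv (Units.mulLeft u) (fun a => ?_) fun a _ => (hF a).symm
  have hu : IsUnit (zmodRed p k u) := u.isUnit.map _
  simp [hu.mul_right_inj]

lemma card_redFiber (b : ZMod (p ^ k)) : (redFiber b).card = p := by
  have h : ∀ b b' : ZMod (p ^ k), (redFiber b).card ≤ (redFiber b').card := by
    intro b b'
    obtain ⟨c, hc⟩ := zmodRed_surjective p k (b' - b)
    refine Finset.card_le_card_of_injOn (fun a => a + c) (fun a ha => ?_)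
      (add_left_injective c).injOn
    simp only [Finset.mem_coe, mem_redFiber, map_add] at ha ⊢
    rw [ha, hc, add_sub_cancel]
  have h1 := sum_redFiber (p := p) (k := k) fun _ => 1
  simp only [Finset.sum_const, smul_eq_mul, mul_one, Finset.card_univ, ZMod.card] at h1
  rw [Finset.sum_congr rfl fun b' _ => (h b' b).antisymm (h b b')] at h1
  simp only [Finset.sum_const, smul_eq_mul, Finset.card_univ, ZMod.card, pow_succ] at h1
  exact Nat.eq_of_mul_eq_mul_left (pow_pos hp.out.pos k) h1

variable {G : Type*} [Group G] [Fintype G] {ψ : G →* (ZMod (p ^ (k + 1)))ˣ}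

-- The group acts freely on nonzero residues, because `(ψ g - 1) * a = 0` forces `a = 0` when `ψ g -
-- 1` is a unit. The whole orbit of `a` stays over the class `0` and shares its value of `x`.
open Classical in
lemma card_le_card_filter_of_ne_zero {x : ZMod (p ^ (k + 1)) → ℝ}
    (hψ : ∀ g, g ≠ 1 → IsUnit ((ψ g : ZMod (p ^ (k + 1))) - 1)) (hx : ∀ g a, x (ψ g * a) = x a)
    {a : ZMod (p ^ (k + 1))} (ha : a ∈ redFiber (0 : ZMod (p ^ k))) (ha0 : a ≠ 0) :
    Fintype.card G ≤ ((redFiber (0 : ZMod (p ^ k))).filter fun b => x b = x a).card := by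
  rw [← Finset.card_univ]
  refine Finset.card_le_card_of_injOn (fun g => (ψ g : ZMod (p ^ (k + 1))) * a) (fun g _ => ?_) ?_
  · rw [mem_redFiber] at ha
    simp [ha, hx]
  · intro g _ g' _ hgg'
    by_contra hne
    have h1 := hψ (g'⁻¹ * g) fun h => hne (inv_mul_eq_one.1 h).symm
    apply ha0
    have h2 : ((ψ (g'⁻¹ * g) : ZMod (p ^ (k + 1))) - 1) * a = 0 := by
      have h3 : (ψ g : ZMod (p ^ (k + 1))) * a = ψ g' * a := hgg'
      rw [map_mul, Units.val_mul, sub_mul, mul_assoc, h3, ← mul_assoc, ← Units.val_mul, ← map_mul]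
      simp
    exact (h1.mul_right_eq_zero).1 h2

/-- The gain over `p ^ 2 / 12` in the covering bound for the fibre above `b`. -/
def fiberGain (p k e : ℕ) (b : ZMod (p ^ k)) : ℝ :=
  if b = 0 then (1 + (p - 1) * (e : ℝ) ^ 2) / (12 * p) else 1 / 12

lemma exists_thresholdRound_redFiber {x : ZMod (p ^ (k + 1)) → ℝ}
    (hψ : ∀ g, g ≠ 1 → IsUnit ((ψ g : ZMod (p ^ (k + 1))) - 1)) (hx : ∀ g a, x (ψ g * a) = x a)
    (b : ZMod (p ^ k)) :
    ∃ t : ℝ, p * ∑ a ∈ redFiber b, (x a - thresholdRound t (x a)) ^ 2 -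
      (∑ a ∈ redFiber b, (x a - thresholdRound t (x a))) ^ 2 ≤
      (p : ℝ) ^ 2 / 12 - fiberGain p k (Fintype.card G) b := by
  classical
  have hp0 : (0 : ℝ) < p := by exact_mod_cast hp.out.pos
  have hne : (redFiber b).Nonempty := by
    rw [← Finset.card_pos, card_redFiber]; exact hp.out.pos
  obtain ⟨t, ht⟩ := exists_thresholdRound_finset_sum_le hne x
  rw [card_redFiber] at ht
  refine ⟨t, ht.trans (sub_le_sub_left ?_ _)⟩
  have h1 : ∀ a ∈ redFiber b, (1 : ℝ) ≤
      (((redFiber b).filter fun b' => x b' = x a).card : ℝ) ^ 2 := by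
    intro a ha
    have : 1 ≤ ((redFiber b).filter fun b' => x b' = x a).card :=
      Finset.card_pos.2 ⟨a, by simpa using ha⟩
    exact one_le_pow₀ (by exact_mod_cast this)
  rw [le_div_iff₀ (by positivity), fiberGain]
  split_ifs with hb
  · subst hb
    -- The residue `0` is only known to agree with itself and contributes `1`; each of the other `p
    -- - 1` contributes at least `e²`.
    have h0 : (0 : ZMod (p ^ (k + 1))) ∈ redFiber (0 : ZMod (p ^ k)) := by simp
    rw [← Finset.add_sum_erase _ _ h0]
    have h2 : ∑ a ∈ (redFiber (0 : ZMod (p ^ k))).erase 0, (Fintype.card G : ℝ) ^ 2 ≤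
        ∑ a ∈ (redFiber (0 : ZMod (p ^ k))).erase 0,
          (((redFiber (0 : ZMod (p ^ k))).filter fun b' => x b' = x a).card : ℝ) ^ 2 := by
      refine Finset.sum_le_sum fun a ha => ?_
      have := card_le_card_filter_of_ne_zero hψ hx (Finset.mem_of_mem_erase ha)
        (Finset.ne_of_mem_erase ha)
      gcongr
    rw [Finset.sum_const, Finset.card_erase_of_mem h0, card_redFiber, nsmul_eq_mul,
      Nat.cast_pred hp.out.pos] at h2
    rw [div_mul_cancel₀ _ (by positivity)]
    linarith [h1 0 h0]
  · have h2 := Finset.sum_le_sum h1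
    rw [Finset.sum_const, card_redFiber, nsmul_eq_mul, mul_one] at h2
    linarith

/-- Simultaneous equivariant rounding of an invariant vector. -/
theorem exists_invariant_round {x : ZMod (p ^ (k + 1)) → ℝ}
    (hψ : ∀ g, g ≠ 1 → IsUnit ((ψ g : ZMod (p ^ (k + 1))) - 1)) (hx : ∀ g a, x (ψ g * a) = x a) :
    ∃ c : ZMod (p ^ (k + 1)) → ℤ, (∀ g a, c (ψ g * a) = c a) ∧
      (p : ℝ) ^ (k + 1) * ∑ a, (x a - c a) ^ 2 -
        (p : ℝ) ^ k * ∑ b : ZMod (p ^ k), (∑ a ∈ redFiber b, (x a - c a)) ^ 2 ≤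
      (p : ℝ) ^ k * (p - 1) *
        (((p : ℝ) ^ (k + 2) + (p : ℝ) ^ (k + 1) + 1 - (Fintype.card G : ℝ) ^ 2) / (12 * p)) := by
  have hp0 : (0 : ℝ) < p := by exact_mod_cast hp.out.pos
  set P : ZMod (p ^ k) → ℝ → Prop := fun b t =>
    p * ∑ a ∈ redFiber b, (x a - thresholdRound t (x a)) ^ 2 -
      (∑ a ∈ redFiber b, (x a - thresholdRound t (x a))) ^ 2 ≤
      (p : ℝ) ^ 2 / 12 - fiberGain p k (Fintype.card G) b with hP
  have hPinv : ∀ g b, P (zmodRed p k (ψ g) * b) = P b := by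
    intro g b
    funext t
    have hu : IsUnit (zmodRed p k (ψ g)) := (ψ g).isUnit.map _
    have e1 := sum_redFiber_unit_mul (F := fun a => (x a - thresholdRound t (x a)) ^ 2) (ψ g)
      (fun a => by simp only [hx]) b
    have e2 := sum_redFiber_unit_mul (F := fun a => x a - thresholdRound t (x a)) (ψ g)
      (fun a => by simp only [hx]) b
    have e3 : fiberGain p k (Fintype.card G) (zmodRed p k (ψ g) * b) =
        fiberGain p k (Fintype.card G) b := by
      simp only [fiberGain, hu.mul_right_eq_zero]
    simp only [hP]
    rw [e1, e2, e3]
  -- `Classical.epsilon` depends only on the predicate, and `P` is constant on orbits, so the chosen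
  -- thresholds are automatically equivariant.
  set T : ZMod (p ^ k) → ℝ := fun b => Classical.epsilon (P b) with hT
  have hTP : ∀ b, P b (T b) := fun b =>
    Classical.epsilon_spec (exists_thresholdRound_redFiber hψ hx b)
  refine ⟨fun a => thresholdRound (T (zmodRed p k a)) (x a), fun g a => ?_, ?_⟩
  · simp only [map_mul, hx, hT, hPinv]
  · have h1 : ∀ b, p * ∑ a ∈ redFiber b, (x a - thresholdRound (T (zmodRed p k a)) (x a)) ^ 2 -
      (∑ a ∈ redFiber b, (x a - thresholdRound (T (zmodRed p k a)) (x a))) ^ 2 ≤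
      (p : ℝ) ^ 2 / 12 - fiberGain p k (Fintype.card G) b := by
      intro b
      convert hTP b using 3
      · refine Finset.sum_congr rfl fun a ha => ?_
        rw [mem_redFiber.1 ha]
      · refine Finset.sum_congr rfl fun a ha => ?_
        rw [mem_redFiber.1 ha]
    have h2 := Finset.sum_le_sum fun b (_ : b ∈ Finset.univ) => h1 b
    rw [Finset.sum_sub_distrib, ← Finset.mul_sum, sum_redFiber] at h2
    have h3 : ∑ b : ZMod (p ^ k), ((p : ℝ) ^ 2 / 12 - fiberGain p k (Fintype.card G) b) =
        (p : ℝ) ^ k * ((p : ℝ) ^ 2 / 12) - ((1 + (p - 1) * (Fintype.card G : ℝ) ^ 2) / (12 * p) +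
          ((p : ℝ) ^ k - 1) * (1 / 12)) := by
      rw [Finset.sum_sub_distrib, Finset.sum_const, Finset.card_univ, ZMod.card, nsmul_eq_mul,
        ← Finset.add_sum_erase _ _ (Finset.mem_univ (0 : ZMod (p ^ k)))]
      have h4 : ∑ b ∈ Finset.univ.erase (0 : ZMod (p ^ k)), fiberGain p k (Fintype.card G) b =
          ∑ b ∈ Finset.univ.erase (0 : ZMod (p ^ k)), 1 / 12 :=
        Finset.sum_congr rfl fun b hb => if_neg (Finset.ne_of_mem_erase hb)
      rw [h4, Finset.sum_const, Finset.card_erase_of_mem (Finset.mem_univ _), Finset.card_univ,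
        ZMod.card, nsmul_eq_mul, Nat.cast_pred (pow_pos hp.out.pos k), fiberGain, if_pos rfl]
      push_cast
      rfl
    rw [h3] at h2
    have h5 := mul_le_mul_of_nonneg_left h2 (pow_nonneg hp0.le k)
    refine le_trans (le_of_eq ?_) (h5.trans (le_of_eq ?_))
    · rw [pow_succ]; ring
    · field_simp
      ring

end Combinatorics

/-! ### The trace form in cyclotomic coordinates -/

section TraceForm

open Polynomial

lemma sum_nthRootsFinset_pow {n : ℕ} [NeZero n] (m : ℕ) :
    ∑ ξ ∈ nthRootsFinset n (1 : ℂ), ξ ^ m = if n ∣ m then (n : ℂ) else 0 := by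
  have hprim := Complex.isPrimitiveRoot_exp n (NeZero.ne n)
  split_ifs with h
  · obtain ⟨j, rfl⟩ := h
    rw [Finset.sum_congr rfl fun ξ hξ => by
      rw [pow_mul, (mem_nthRootsFinset (NeZero.pos n) _).1 hξ, one_pow]]
    simp [hprim.card_nthRootsFinset]
  · set ω := Complex.exp (2 * Real.pi * Complex.I / n)
    have hω : ω ≠ 0 := hprim.ne_zero (NeZero.ne n)
    have h1 : ∑ ξ ∈ nthRootsFinset n (1 : ℂ), (ω * ξ) ^ m = ∑ ξ ∈ nthRootsFinset n (1 : ℂ), ξ ^ m := by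
      refine Finset.sum_equiv (Equiv.mulLeft₀ ω hω) (fun ξ => ?_) fun _ _ => rfl
      simp [mem_nthRootsFinset (NeZero.pos n), mul_pow, hprim.pow_eq_one]
    simp_rw [mul_pow, ← Finset.mul_sum] at h1
    by_contra hne
    exact h ((hprim.pow_eq_one_iff_dvd m).1 (mul_right_cancel₀ hne (h1.trans (one_mul _).symm)))

lemma primitiveRoots_prime_pow {p k : ℕ} (hp : p.Prime) :
    primitiveRoots (p ^ (k + 1)) ℂ =
      nthRootsFinset (p ^ (k + 1)) (1 : ℂ) \ nthRootsFinset (p ^ k) (1 : ℂ) := by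
  have := Fact.mk hp
  ext ξ
  rw [Finset.mem_sdiff, mem_primitiveRoots (pow_pos hp.pos _),
    mem_nthRootsFinset (pow_pos hp.pos _), mem_nthRootsFinset (pow_pos hp.pos _)]
  constructor
  · intro h
    exact ⟨h.pow_eq_one, fun h' => absurd (h.dvd_of_pow_eq_one _ h')
      (Nat.not_dvd_of_pos_of_lt (pow_pos hp.pos _) (Nat.pow_lt_pow_right hp.one_lt k.lt_succ_self))⟩
  · rintro ⟨h1, h2⟩
    rw [IsPrimitiveRoot.iff_orderOf]
    exact orderOf_eq_prime_pow h2 h1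

variable {p k : ℕ} [hp : Fact p.Prime] {L : Type*} [Field L] [NumberField L]
  [IsCyclotomicExtension {p ^ (k + 1)} ℚ L] {ζ : L} (hζ : IsPrimitiveRoot ζ (p ^ (k + 1)))

/-- A Ramanujan sum: primitive `p ^ (k + 1)`-th roots of unity are all such roots minus the `p ^
k`-th ones. -/
lemma sum_embeddings_zmodChar (a : ZMod (p ^ (k + 1))) :
    ∑ σ : L →ₐ[ℚ] ℂ, σ (AddChar.zmodChar _ hζ.pow_eq_one a) =
      (if a = 0 then (p : ℂ) ^ (k + 1) else 0) - if zmodRed p k a = 0 then (p : ℂ) ^ k else 0 := by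
  have h1 : ∑ σ : L →ₐ[ℚ] ℂ, σ (AddChar.zmodChar _ hζ.pow_eq_one a) =
      ∑ ξ ∈ primitiveRoots (p ^ (k + 1)) ℂ, ξ ^ a.val := by
    rw [← Finset.sum_coe_sort (primitiveRoots (p ^ (k + 1)) ℂ) fun ξ => ξ ^ a.val]
    refine Fintype.sum_equiv (hζ.embeddingsEquivPrimitiveRoots ℂ
      (cyclotomic.irreducible_rat (NeZero.pos _))) _ _ fun σ => ?_
    rw [AddChar.zmodChar_apply, map_pow, hζ.embeddingsEquivPrimitiveRoots_apply_coe]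
  rw [h1, primitiveRoots_prime_pow hp.out, Finset.sum_sdiff_eq_sub, sum_nthRootsFinset_pow,
    sum_nthRootsFinset_pow]
  · have e1 : p ^ (k + 1) ∣ a.val ↔ a = 0 := by
      rw [← ZMod.natCast_eq_zero_iff, ZMod.natCast_zmod_val]
    have e2 : p ^ k ∣ a.val ↔ zmodRed p k a = 0 := by
      rw [← ZMod.natCast_eq_zero_iff, ← map_natCast (zmodRed p k), ZMod.natCast_zmod_val]
    simp only [e1, e2]
    push_cast
    rfl
  · intro ξ
    rw [mem_nthRootsFinset (NeZero.pos _), mem_nthRootsFinset (NeZero.pos _), pow_succ, pow_mul]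
    intro h
    rw [h, one_pow]

/-- The trace form `z ↦ Tr (z * conj z)` of a prime power cyclotomic field in terms of the
coordinates of `z` with respect to the roots of unity. -/
theorem sum_embeddings_norm_sq (v : ZMod (p ^ (k + 1)) → ℚ) :
    ∑ σ : L →ₐ[ℚ] ℂ, ‖σ (∑ a, v a • AddChar.zmodChar _ hζ.pow_eq_one a)‖ ^ 2 =
      (p : ℝ) ^ (k + 1) * ∑ a, (v a : ℝ) ^ 2 -
        (p : ℝ) ^ k * ∑ b : ZMod (p ^ k), (∑ a ∈ redFiber b, (v a : ℝ)) ^ 2 := by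
  set χ := AddChar.zmodChar _ hζ.pow_eq_one with hχ
  have h1 : ∀ σ : L →ₐ[ℚ] ℂ, ((‖σ (∑ a, v a • χ a)‖ ^ 2 : ℝ) : ℂ) =
      ∑ a, ∑ b, (v a : ℂ) * (v b : ℂ) * σ (χ (a - b)) := by
    intro σ
    have hconj : ∀ b, (starRingEnd ℂ) (σ (χ b)) = σ (χ (-b)) := fun b =>
      (AddChar.map_neg_eq_conj ((σ : L →* ℂ).compAddChar χ) b).symm
    push_cast
    rw [← Complex.mul_conj', map_sum, map_sum, Finset.sum_mul_sum]
    refine Finset.sum_congr rfl fun a _ => Finset.sum_congr rfl fun b _ => ?_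
    rw [map_rat_smul, map_rat_smul, Rat.smul_def, Rat.smul_def, map_mul, hconj, map_ratCast, sub_eq_add_neg,
      AddChar.map_add_eq_mul, map_mul]
    ring
  have h2 : ((∑ σ : L →ₐ[ℚ] ℂ, ‖σ (∑ a, v a • χ a)‖ ^ 2 : ℝ) : ℂ) =
      ∑ a, ∑ b, (v a : ℂ) * (v b : ℂ) * ((if a = b then (p : ℂ) ^ (k + 1) else 0) -
        if zmodRed p k a = zmodRed p k b then (p : ℂ) ^ k else 0) := by
    rw [Complex.ofReal_sum, Finset.sum_congr rfl fun σ _ => h1 σ, Finset.sum_comm]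
    refine Finset.sum_congr rfl fun a _ => ?_
    rw [Finset.sum_comm]
    refine Finset.sum_congr rfl fun b _ => ?_
    rw [← Finset.mul_sum, sum_embeddings_zmodChar hζ, map_sub]
    simp only [sub_eq_zero]
  have h3 : ∑ a, ∑ b, (v a : ℂ) * (v b : ℂ) *
      (if zmodRed p k a = zmodRed p k b then (p : ℂ) ^ k else 0) =
      (p : ℂ) ^ k * ∑ b : ZMod (p ^ k), (∑ a ∈ redFiber b, (v a : ℂ)) ^ 2 := by
    simp_rw [sq, Finset.sum_mul_sum]
    rw [← sum_redFiber, Finset.mul_sum]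
    refine Finset.sum_congr rfl fun c _ => ?_
    rw [Finset.mul_sum]
    refine Finset.sum_congr rfl fun a ha => ?_
    rw [mem_redFiber] at ha
    rw [redFiber, Finset.sum_filter, Finset.mul_sum]
    refine Finset.sum_congr rfl fun b _ => ?_
    rw [ha]
    by_cases h : zmodRed p k b = c
    · rw [if_pos h.symm, if_pos h]; ring
    · rw [if_neg (Ne.symm h), if_neg h]; ring
  apply Complex.ofReal_injective
  rw [h2]
  simp_rw [mul_sub, Finset.sum_sub_distrib]
  rw [h3]
  push_cast
  congr 1
  rw [Finset.mul_sum]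
  refine Finset.sum_congr rfl fun a _ => ?_
  simp
  ring

lemma exists_coord (x : L) :
    ∃ v : ZMod (p ^ (k + 1)) → ℚ, ∑ a, v a • AddChar.zmodChar _ hζ.pow_eq_one a = x := by
  rw [← Submodule.mem_span_range_iff_exists_fun]
  have h1 : x ∈ Algebra.adjoin ℚ {ζ} := by
    rw [IsCyclotomicExtension.adjoin_primitive_root_eq_top hζ]; trivial
  rw [← Subalgebra.mem_toSubmodule, Algebra.adjoin_eq_span] at h1
  refine Submodule.span_mono ?_ h1
  intro y hy
  obtain ⟨n, rfl⟩ := Submonoid.mem_closure_singleton.1 hy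
  exact ⟨n, AddChar.zmodChar_apply' _ n⟩

variable {K : Type*} [Field K] [NumberField K] [Algebra K L]

omit [NumberField L] [IsCyclotomicExtension {p ^ (k + 1)} ℚ L] [NumberField K] in
lemma map_zmodChar (h : L ≃ₐ[K] L) (a : ZMod (p ^ (k + 1))) :
    h (AddChar.zmodChar _ hζ.pow_eq_one a) =
      AddChar.zmodChar _ hζ.pow_eq_one (hζ.autToPow K h * a) := by
  rw [AddChar.zmodChar_apply, map_pow, ← hζ.autToPow_spec K h, ← pow_mul,
    ← AddChar.zmodChar_apply' hζ.pow_eq_one]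
  push_cast
  rw [ZMod.natCast_zmod_val, ZMod.natCast_zmod_val]

omit [IsCyclotomicExtension {p ^ (k + 1)} ℚ L] [NumberField K] in
lemma map_sum_zmodChar (h : L ≃ₐ[K] L) (v : ZMod (p ^ (k + 1)) → ℚ) :
    h (∑ a, v (hζ.autToPow K h * a) • AddChar.zmodChar _ hζ.pow_eq_one a) =
      ∑ a, v a • AddChar.zmodChar _ hζ.pow_eq_one a := by
  rw [map_sum]
  refine Fintype.sum_equiv (Units.mulLeft (hζ.autToPow K h)) _ _ fun a => ?_
  rw [map_rat_smul, map_zmodChar]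
  rfl

/-- The powers of `ζ` are linearly dependent, so coordinates of an element of `K` need not be
invariant; averaging any choice over the Galois group makes them so. -/
lemma exists_invariant_coord (x : K) :
    ∃ v : ZMod (p ^ (k + 1)) → ℚ, (∀ (h : L ≃ₐ[K] L) a, v (hζ.autToPow K h * a) = v a) ∧
      ∑ a, v a • AddChar.zmodChar _ hζ.pow_eq_one a = algebraMap K L x := by
  obtain ⟨w, hw⟩ := exists_coord hζ (algebraMap K L x)
  have hcard : (Fintype.card (L ≃ₐ[K] L) : ℚ) ≠ 0 := by
    exact_mod_cast Fintype.card_ne_zero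
  refine ⟨fun a => (Fintype.card (L ≃ₐ[K] L) : ℚ)⁻¹ * ∑ h : L ≃ₐ[K] L,
    w (hζ.autToPow K h * a), fun h a => ?_, ?_⟩
  · have : ∑ g : L ≃ₐ[K] L, w (hζ.autToPow K g * (hζ.autToPow K h * a)) =
        ∑ g : L ≃ₐ[K] L, w (hζ.autToPow K g * a) :=
      Fintype.sum_equiv (Equiv.mulRight h) _ _ fun g => by simp [mul_assoc]
    simp only [this]
  · simp_rw [mul_smul, ← Finset.smul_sum, Finset.sum_smul]
    rw [Finset.sum_comm]
    have h1 : ∀ h : L ≃ₐ[K] L, ∑ a, w (hζ.autToPow K h * a) •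
        AddChar.zmodChar _ hζ.pow_eq_one a = algebraMap K L x := by
      intro h
      apply h.injective
      rw [map_sum_zmodChar, hw, h.commutes]
    simp_rw [h1]
    rw [Finset.sum_const, Finset.card_univ,
      ← Nat.cast_smul_eq_nsmul ℚ, smul_smul, inv_mul_cancel₀ hcard, one_smul]

include hζ in
/-- Covering bound for `𝓞 K` with respect to the trace form. -/
theorem exists_sum_embeddings_norm_sq_le (hdvd : ¬ p ∣ Module.finrank K L) (x : K) :
    ∃ c : 𝓞 K, ∑ σ : L →ₐ[ℚ] ℂ, ‖σ (algebraMap K L (x - c))‖ ^ 2 ≤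
      (p : ℝ) ^ k * (p - 1) *
        (((p : ℝ) ^ (k + 2) + (p : ℝ) ^ (k + 1) + 1 - (Module.finrank K L : ℝ) ^ 2) /
          (12 * p)) := by
  have := isCyclotomicExtension_of_tower (K := K) (L := L) (p ^ (k + 1))
  have : IsGalois K L := IsCyclotomicExtension.isGalois {p ^ (k + 1)} K L
  obtain ⟨v, hv, hvx⟩ := exists_invariant_coord hζ x
  obtain ⟨c, hc, hcb⟩ := exists_invariant_round (ψ := hζ.autToPow K) (x := fun a => (v a : ℝ))
    (fun h hh => isUnit_autToPow_sub_one hζ hdvd hh) (fun h a => by rw [hv])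
  set y : L := ∑ a, (c a : ℚ) • AddChar.zmodChar _ hζ.pow_eq_one a with hy
  -- Invariant rounded coordinates make `y` Galois-fixed, so it descends to an integer of `K`.
  have hfix : ∀ h : L ≃ₐ[K] L, h y = y := by
    intro h
    conv_rhs => rw [hy, ← map_sum_zmodChar hζ h]
    simp only [hc, hy]
  obtain ⟨z, hz⟩ := (IsGalois.mem_range_algebraMap_iff_fixed y).2 hfix
  have hyint : IsIntegral ℤ y := by
    refine IsIntegral.sum _ fun a _ => ?_
    rw [Rat.smul_def, Rat.cast_intCast, AddChar.zmodChar_apply]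
    exact (isIntegral_algebraMap (R := ℤ) (x := c a)).mul
      ((hζ.isIntegral (NeZero.pos _)).pow _)
  have hzint : IsIntegral ℤ z := by
    rw [← hz] at hyint
    exact (isIntegral_algebraMap_iff (algebraMap K L).injective).1 hyint
  obtain ⟨w, rfl⟩ : ∃ w : 𝓞 K, (w : K) = z := ⟨⟨z, hzint⟩, rfl⟩
  refine ⟨w, ?_⟩
  have hdiff : algebraMap K L (x - w) =
      ∑ a, (v a - c a : ℚ) • AddChar.zmodChar _ hζ.pow_eq_one a := by
    rw [map_sub, ← hvx]
    simp_rw [sub_smul, Finset.sum_sub_distrib]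
    rw [← hy, ← hz]
  rw [hdiff, sum_embeddings_norm_sq hζ]
  push_cast
  rwa [← IsGalois.card_aut_eq_finrank, Nat.card_eq_fintype_card]


end TraceForm

/-! ### From the trace form to the norm -/

section Norm

variable {L : Type*} [Field L] [NumberField L]

lemma prod_le_sum_div_card_pow {ι : Type*} [Fintype ι] [Nonempty ι] {z : ι → ℝ}
    (hz : ∀ i, 0 ≤ z i) : ∏ i, z i ≤ ((∑ i, z i) / Fintype.card ι) ^ Fintype.card ι := by
  have hN : (0 : ℝ) < Fintype.card ι := by exact_mod_cast Fintype.card_pos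
  have h := Real.geom_mean_le_arith_mean Finset.univ (fun _ => (1 : ℝ)) z (by simp)
    (by simpa [Fintype.card_pos_iff])
    fun i _ => hz i
  simp only [Real.rpow_one, Finset.sum_const, Finset.card_univ, nsmul_eq_mul, mul_one,
    one_mul] at h
  have hprod : 0 ≤ ∏ i, z i := Finset.prod_nonneg fun i _ => hz i
  have h2 := pow_le_pow_left₀ (by positivity) h (Fintype.card ι)
  rwa [← Real.rpow_natCast, ← Real.rpow_mul hprod, inv_mul_cancel₀ hN.ne', Real.rpow_one] at h2

lemma abs_norm_sq_le (z : L) :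
    |((Algebra.norm ℚ z : ℚ) : ℝ)| ^ 2 ≤
      ((∑ σ : L →ₐ[ℚ] ℂ, ‖σ z‖ ^ 2) / Module.finrank ℚ L) ^ Module.finrank ℚ L := by
  have h1 := Algebra.norm_eq_prod_embeddings ℚ ℂ z
  have h2 : |((Algebra.norm ℚ z : ℚ) : ℝ)| = ∏ σ : L →ₐ[ℚ] ℂ, ‖σ z‖ := by
    rw [← norm_prod, ← h1]
    simp
  have hcard : Fintype.card (L →ₐ[ℚ] ℂ) = Module.finrank ℚ L := AlgHom.card ℚ L ℂ
  have : Nonempty (L →ₐ[ℚ] ℂ) := by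
    rw [← Fintype.card_pos_iff, hcard]; exact Module.finrank_pos
  rw [h2, ← Finset.prod_pow, ← hcard]
  exact prod_le_sum_div_card_pow fun σ => by positivity

lemma abs_norm_pow_finrank {K : Type*} [Field K] [NumberField K] [Algebra K L] (z : K) :
    |((Algebra.norm ℚ (algebraMap K L z) : ℚ) : ℝ)| =
      |((Algebra.norm ℚ z : ℚ) : ℝ)| ^ Module.finrank K L := by
  rw [← Algebra.norm_norm (S := K), Algebra.norm_algebraMap, map_pow, Rat.cast_pow, abs_pow]

end Norm

/-! ### The discriminant of a tame cyclotomic extension -/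

section Discriminant

open Polynomial

variable {K L : Type*} [Field K] [NumberField K] [Field L] [NumberField L] [Algebra K L]

/-- The derivative of the minimal polynomial of a generator of a Galois extension. -/
lemma aeval_derivative_minpoly_eq_prod [IsGalois K L] [DecidableEq (L ≃ₐ[K] L)] {x : L}
    (hx : Algebra.adjoin K {x} = ⊤) :
    aeval x (derivative (minpoly K x)) =
      ∏ h ∈ Finset.univ.erase (1 : L ≃ₐ[K] L), (x - h x) := by
  have hint : IsIntegral K x := Algebra.IsIntegral.isIntegral x
  have hinj : Function.Injective fun h : L ≃ₐ[K] L => h x := by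
    intro g h hgh
    have : (g : L →ₐ[K] L) = h := AlgHom.ext_of_adjoin_eq_top hx (by
      rintro y rfl
      exact hgh)
    ext y
    exact DFunLike.congr_fun this y
  have hdeg : (minpoly K x).natDegree = Fintype.card (L ≃ₐ[K] L) := by
    rw [← Nat.card_eq_fintype_card, IsGalois.card_aut_eq_finrank,
      (PowerBasis.ofAdjoinEqTop hint hx).finrank, ← PowerBasis.natDegree_minpoly,
      PowerBasis.ofAdjoinEqTop_gen]
  have hdvd : ∏ h : L ≃ₐ[K] L, (X - C (h x)) ∣ (minpoly K x).map (algebraMap K L) := by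
    refine Finset.prod_dvd_of_coprime ?_ ?_
    · intro g _ h _ hgh
      exact pairwise_coprime_X_sub_C hinj hgh
    · intro h _
      rw [dvd_iff_isRoot, IsRoot.def, eval_map_algebraMap, aeval_algHom_apply, minpoly.aeval,
        map_zero]
  have heq : (minpoly K x).map (algebraMap K L) = ∏ h : L ≃ₐ[K] L, (X - C (h x)) := by
    refine (eq_of_monic_of_dvd_of_natDegree_le ?_ ((minpoly.monic hint).map _) hdvd ?_)
    · exact monic_prod_of_monic _ _ fun h _ => monic_X_sub_C _
    · rw [natDegree_map, hdeg, natDegree_prod_of_monic _ _ fun h _ => monic_X_sub_C _]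
      simp
  rw [← eval_map_algebraMap, ← derivative_map, heq,
    ← Finset.mul_prod_erase _ _ (Finset.mem_univ (1 : L ≃ₐ[K] L)), derivative_mul]
  simp [eval_prod]

variable {p k : ℕ} [hp : Fact p.Prime]

/-- Bound for the discriminant of `ℚ(ζ_{p ^ (k + 1)})` in terms of the one of a subfield over which
it is tamely ramified. -/
theorem natAbs_discr_le_of_tame [IsCyclotomicExtension {p ^ (k + 1)} ℚ L]
    (hdvd : ¬ p ∣ Module.finrank K L) :
    (NumberField.discr L).natAbs ≤
      p ^ (Module.finrank K L - 1) * (NumberField.discr K).natAbs ^ Module.finrank K L := by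
  classical
  have := isCyclotomicExtension_of_tower (K := K) (L := L) (p ^ (k + 1))
  have : IsGalois K L := IsCyclotomicExtension.isGalois {p ^ (k + 1)} K L
  obtain ⟨ζ, hζ⟩ := IsCyclotomicExtension.exists_isPrimitiveRoot ℚ L
    (Set.mem_singleton (p ^ (k + 1))) (NeZero.ne _)
  have hadj := IsCyclotomicExtension.adjoin_primitive_root_eq_top (A := K) hζ
  rw [NumberField.natAbs_discr_eq_absNorm_differentIdeal_mul_natAbs_discr_pow K (𝓞 K) L (𝓞 L)]
  refine Nat.mul_le_mul_right _ ?_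
  set x : 𝓞 L := hζ.toInteger with hx
  have hxL : algebraMap (𝓞 L) L x = ζ := rfl
  -- Membership of this derivative in the different suffices; the different need not be computed
  -- exactly.
  have hmem := aeval_derivative_mem_differentIdeal (𝓞 K) K L x (by rw [hxL]; exact hadj)
  set d : 𝓞 L := aeval x (derivative (minpoly (𝓞 K) x)) with hd
  have hdL : algebraMap (𝓞 L) L d = ∏ h ∈ Finset.univ.erase (1 : L ≃ₐ[K] L), (ζ - h ζ) := by
    rw [← aeval_derivative_minpoly_eq_prod hadj, hd, ← hxL,
      minpoly.isIntegrallyClosed_eq_field_fractions K L (Algebra.IsIntegral.isIntegral (R := 𝓞 K) x),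
      derivative_map, aeval_map_algebraMap, aeval_algebraMap_apply]
  -- Here `x - x ^ u = -x * (x ^ (u - 1) - 1)`, and `u - 1` is prime to `p`, so the last factor is a
  -- unit times `x - 1`.
  have hterm : ∀ h ∈ Finset.univ.erase (1 : L ≃ₐ[K] L),
      Associated (x - 1) (x - x ^ (hζ.autToPow K h : ZMod (p ^ (k + 1))).val) := by
    intro h hh
    have hu := isUnit_autToPow_sub_one hζ hdvd (Finset.ne_of_mem_erase hh)
    have hprim := hζ.toInteger_isPrimitiveRoot
    have hpow : x ^ (hζ.autToPow K h : ZMod (p ^ (k + 1))).val =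
        x ^ ((hζ.autToPow K h : ZMod (p ^ (k + 1))) - 1).val * x := by
      conv_rhs => rw [← pow_one x, ← pow_mul, one_mul]
      rw [← AddChar.zmodChar_apply' hprim.pow_eq_one, ← AddChar.zmodChar_apply' hprim.pow_eq_one,
        ← AddChar.zmodChar_apply' hprim.pow_eq_one, ← AddChar.map_add_eq_mul]
      simp
    have hcop : ((hζ.autToPow K h : ZMod (p ^ (k + 1))) - 1).val.Coprime (p ^ (k + 1)) := by
      rw [← ZMod.isUnit_iff_coprime]; simpa using hu
    have h1 := hprim.associated_sub_one_pow_sub_one_of_coprime hcop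
    have h2 : IsUnit (-x) := (hprim.isUnit (NeZero.ne _)).neg
    rw [hpow]
    refine h1.trans ⟨h2.unit, ?_⟩
    rw [IsUnit.unit_spec]
    ring
  have hdx : d = ∏ h ∈ Finset.univ.erase (1 : L ≃ₐ[K] L),
      (x - x ^ (hζ.autToPow K h : ZMod (p ^ (k + 1))).val) := by
    apply FaithfulSMul.algebraMap_injective (𝓞 L) L
    rw [hdL, map_prod]
    refine Finset.prod_congr rfl fun h _ => ?_
    rw [map_sub, map_pow, hxL, hζ.autToPow_spec K h]
  have hassoc : Associated ((x - 1) ^ (Module.finrank K L - 1)) d := by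
    rw [hdx, ← IsGalois.card_aut_eq_finrank, Nat.card_eq_fintype_card, ← Finset.card_univ,
      ← Finset.card_erase_of_mem (Finset.mem_univ (1 : L ≃ₐ[K] L)), ← Finset.prod_const]
    exact Associated.prod _ _ _ hterm
  have hle : differentIdeal (𝓞 K) (𝓞 L) ∣ Ideal.span {x - 1} ^ (Module.finrank K L - 1) := by
    rw [Ideal.span_singleton_pow, Ideal.dvd_iff_le, Ideal.span_singleton_le_iff_mem]
    exact (Ideal.mem_iff_of_associated hassoc).2 hmem
  have hn := map_dvd Ideal.absNorm hle
  rw [map_pow, IsCyclotomicExtension.Rat.absNorm_span_zeta_sub_one p k hζ] at hn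
  exact Nat.le_of_dvd (pow_pos hp.out.pos _) hn

end Discriminant

/-! ### Real estimates for `ω` -/

lemma constC_sq_le {p r e : ℕ} (hp : 0 < p) (he : 1 ≤ e) :
    ((p : ℝ) ^ (r + 1) + (p : ℝ) ^ r + 1 - (e : ℝ) ^ 2) / (12 * (p : ℝ) ^ (r + 1)) ≤
      (1 + 1 / (p : ℝ)) / 12 := by
  have hp' : (0 : ℝ) < p := by exact_mod_cast hp
  have he' : (1 : ℝ) ≤ e := by exact_mod_cast he
  rw [div_le_iff₀ (by positivity)]
  have : (1 + 1 / (p : ℝ)) / 12 * (12 * (p : ℝ) ^ (r + 1)) = (p : ℝ) ^ (r + 1) + (p : ℝ) ^ r := by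
    rw [pow_succ]; field_simp
  rw [this]
  nlinarith

lemma le_constC_sq {p r e : ℕ} (hp : 0 < p) (he : e ^ 2 ≤ p ^ r + 1) :
    1 / 12 ≤ ((p : ℝ) ^ (r + 1) + (p : ℝ) ^ r + 1 - (e : ℝ) ^ 2) / (12 * (p : ℝ) ^ (r + 1)) := by
  have hp' : (0 : ℝ) < p := by exact_mod_cast hp
  have he' : (e : ℝ) ^ 2 ≤ (p : ℝ) ^ r + 1 := by exact_mod_cast he
  rw [le_div_iff₀ (by positivity)]
  linarith

lemma one_div_two_mul_sqrt_three : 1 / (2 * √3) = √((1 : ℝ) / 12) := by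
  rw [eq_comm, Real.sqrt_eq_iff_mul_self_eq (by positivity) (by positivity)]
  have : √(3 : ℝ) * √3 = 3 := Real.mul_self_sqrt (by norm_num)
  field_simp
  linarith

lemma tendsto_sqrt_mul_sqrt_rpow (c : ℝ) :
    Filter.Tendsto (fun x : ℝ => √((1 + 1 / x) / 12) * √x ^ (c / x)) Filter.atTop
      (nhds (1 / (2 * √3))) := by
  rw [one_div_two_mul_sqrt_three]
  have h1 : Filter.Tendsto (fun x : ℝ => √((1 + 1 / x) / 12)) Filter.atTop (nhds √(1 / 12)) := by
    refine (Real.continuous_sqrt.tendsto _).comp ?_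
    have : Filter.Tendsto (fun x : ℝ => (1 + 1 / x) / 12) Filter.atTop (nhds ((1 + 0) / 12)) := by
      refine ((tendsto_const_nhds.add ?_).div_const 12)
      exact (tendsto_inv_atTop_zero (𝕜 := ℝ)).congr fun x => (one_div x).symm
    simpa using this
  have h2 : Filter.Tendsto (fun x : ℝ => √x ^ (c / x)) Filter.atTop (nhds 1) := by
    refine (tendsto_rpow_div_mul_add c 2 0 (by norm_num)).congr' ?_
    filter_upwards [Filter.eventually_gt_atTop 0] with x hx
    rw [Real.sqrt_eq_rpow, ← Real.rpow_mul hx.le]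
    congr 1
    field_simp
    ring
  simpa using h1.mul h2

lemma sqrt_mul_rpow_bounds {p r e : ℕ} {E c : ℝ} (hp : 0 < p) (he : 1 ≤ e)
    (he' : e ^ 2 ≤ p ^ r + 1) (hE : 0 ≤ E) (hEc : E ≤ c / p) :
    1 / (2 * √3) ≤ √(((p : ℝ) ^ (r + 1) + (p : ℝ) ^ r + 1 - (e : ℝ) ^ 2) /
        (12 * (p : ℝ) ^ (r + 1))) * √(p : ℝ) ^ E ∧
      √(((p : ℝ) ^ (r + 1) + (p : ℝ) ^ r + 1 - (e : ℝ) ^ 2) /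
        (12 * (p : ℝ) ^ (r + 1))) * √(p : ℝ) ^ E ≤ √((1 + 1 / (p : ℝ)) / 12) * √(p : ℝ) ^ (c / p) := by
  have hp' : (1 : ℝ) ≤ √(p : ℝ) := by
    rw [Real.one_le_sqrt]; exact_mod_cast hp
  rw [one_div_two_mul_sqrt_three]
  constructor
  · exact (Real.sqrt_le_sqrt (le_constC_sq hp he')).trans
      (le_mul_of_one_le_right (Real.sqrt_nonneg _) (Real.one_le_rpow hp' hE))
  · gcongr ?_ * ?_
    · exact Real.sqrt_le_sqrt (constC_sq_le hp he)
    · exact Real.rpow_le_rpow_of_exponent_le hp' hEc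

/-- Equivalent to `n ^ (1/n) ≤ 3 ^ (1/3)`. -/
lemma cube_le_three_pow : ∀ n : ℕ, 3 ≤ n → n ^ 3 ≤ 3 ^ n := by
  intro n hn
  induction n, hn using Nat.le_induction with
  | base => norm_num
  | succ k hk ih =>
    rw [pow_succ 3 k]
    nlinarith [mul_le_mul hk hk (by norm_num) (by omega)]

/-- Both factors are largest at `p = 3`, where they equal `1/3` and `3 ^ (1/3)`. -/
lemma sqrt_mul_sqrt_rpow_le {p : ℕ} (hp : 3 ≤ p) :
    √((1 + 1 / (p : ℝ)) / 12) * √(p : ℝ) ^ (2 / (p : ℝ)) ≤ (3 : ℝ) ^ (-(2 / 3) : ℝ) := by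
  have hp' : (3 : ℝ) ≤ p := by exact_mod_cast hp
  have h1 : √((1 + 1 / (p : ℝ)) / 12) ≤ 1 / 3 := by
    rw [Real.sqrt_le_left (by norm_num)]
    have : 1 / (p : ℝ) ≤ 1 / 3 := one_div_le_one_div_of_le (by norm_num) hp'
    linarith
  have h2 : √(p : ℝ) ^ (2 / (p : ℝ)) ≤ (3 : ℝ) ^ (1 / 3 : ℝ) := by
    rw [Real.sqrt_eq_rpow, ← Real.rpow_mul (by positivity)]
    have h3 : ((p : ℝ) ^ (3 : ℝ)) ≤ (3 : ℝ) ^ (p : ℝ) := by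
      rw [Real.rpow_natCast]
      exact_mod_cast cube_le_three_pow p hp
    have h4 := Real.rpow_le_rpow (by positivity) h3 (z := 1 / (3 * p)) (by positivity)
    rw [← Real.rpow_mul (by positivity), ← Real.rpow_mul (by positivity)] at h4
    convert h4 using 2 <;> field_simp
  calc _ ≤ 1 / 3 * (3 : ℝ) ^ (1 / 3 : ℝ) := by gcongr
    _ = (3 : ℝ) ^ (-(2 / 3) : ℝ) := by
      rw [show (-(2 / 3) : ℝ) = -1 + 1 / 3 by norm_num, Real.rpow_add (by norm_num),
        Real.rpow_neg_one]
      norm_num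

lemma exponent_eq {p r e n : ℕ} (hp : 2 ≤ p) (he : 1 ≤ e) (hn : n * e = p ^ (r - 1) * (p - 1)) :
    ((p : ℝ) ^ (r - 1) - 1) / ((p : ℝ) ^ (r - 1) * ((p : ℝ) - 1)) + 1 / (n : ℝ) =
      ((p : ℝ) ^ (r - 1) - 1 + e) / ((p : ℝ) ^ (r - 1) * ((p : ℝ) - 1)) := by
  have h : (n : ℝ) * e = (p : ℝ) ^ (r - 1) * ((p : ℝ) - 1) := by
    rw [← Nat.cast_pred (by omega)]; exact_mod_cast hn
  have he' : (e : ℝ) ≠ 0 := by positivity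
  have hn' : (n : ℝ) ≠ 0 := by
    rintro h0
    have hp' : (2 : ℝ) ≤ p := by exact_mod_cast hp
    rw [h0, zero_mul] at h
    have : 0 < (p : ℝ) ^ (r - 1) * ((p : ℝ) - 1) := mul_pos (by positivity) (by linarith)
    linarith
  rw [← h]
  field_simp

lemma exponent_nonneg {p r e : ℕ} (hp : 2 ≤ p) :
    0 ≤ ((p : ℝ) ^ (r - 1) - 1 + e) / ((p : ℝ) ^ (r - 1) * ((p : ℝ) - 1)) := by
  have hp' : (2 : ℝ) ≤ p := by exact_mod_cast hp
  have h1 : (1 : ℝ) ≤ (p : ℝ) ^ (r - 1) := one_le_pow₀ (by linarith)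
  exact div_nonneg (by linarith [Nat.cast_nonneg (α := ℝ) e]) (mul_nonneg (by linarith) (by linarith))

lemma exponent_le_two_div {p r e : ℕ} (hp : 2 ≤ p) (he : e ≤ p - 1) (hr : 2 ≤ r) :
    ((p : ℝ) ^ (r - 1) - 1 + e) / ((p : ℝ) ^ (r - 1) * ((p : ℝ) - 1)) ≤ 2 / p := by
  have hp' : (2 : ℝ) ≤ p := by exact_mod_cast hp
  have he' : (e : ℝ) ≤ p - 1 := by
    rw [← Nat.cast_pred (by omega)]; exact_mod_cast he
  have h1 : (p : ℝ) ≤ (p : ℝ) ^ (r - 1) := le_self_pow₀ (by linarith) (by omega)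
  rw [div_le_div_iff₀ (mul_pos (by linarith) (by linarith)) (by linarith)]
  nlinarith

lemma exponent_le_of_eq_one {p e : ℕ} (hp : 2 ≤ p) :
    ((p : ℝ) ^ (1 - 1) - 1 + e) / ((p : ℝ) ^ (1 - 1) * ((p : ℝ) - 1)) ≤ (2 * e : ℝ) / p := by
  have hp' : (2 : ℝ) ≤ p := by exact_mod_cast hp
  have he : (0 : ℝ) ≤ e := by positivity
  simp only [Nat.sub_self, pow_zero, sub_self, zero_add, one_mul]
  rw [div_le_div_iff₀ (by linarith) (by linarith)]
  nlinarith

/-! ### Invariants of `K` and the three assertions -/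

section Main

lemma exists_ringHom_codegreeE_eq {K : Type u} [Field K] [NumberField K] {m : ℕ}
    (hm : conductor K = m) (hm0 : m ≠ 0) :
    ∃ f : K →+* CyclotomicField m ℚ,
      codegreeE K = Module.finrank f.fieldRange (CyclotomicField m ℚ) := by
  subst hm
  -- Since `sInf ∅ = 0`, a nonzero conductor is really attained.
  have h : Nonempty (K →+* CyclotomicField (conductor K) ℚ) :=
    (Nat.sInf_mem (Nat.nonempty_of_pos_sInf (Nat.pos_of_ne_zero hm0))).2
  exact ⟨h.some, by rw [codegreeE, dif_pos h]⟩

lemma finrank_fieldRange {K L : Type*} [Field K] [Field L] [Algebra K L] :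
    Module.finrank (algebraMap K L).fieldRange L = Module.finrank K L :=
  (Algebra.finrank_eq_of_equiv_equiv (algebraMap K L).rangeRestrictFieldEquiv (RingEquiv.refl L)
    (by ext; rfl)).symm

lemma primeP_eq {K : Type u} [Field K] [NumberField K] {p k : ℕ} (hp : p.Prime)
    (hc : conductor K = p ^ (k + 1)) : primeP K = p := by
  rw [primeP, hc, hp.pow_minFac k.succ_ne_zero]

lemma expR_eq {K : Type u} [Field K] [NumberField K] {p k : ℕ} (hp : p.Prime)
    (hc : conductor K = p ^ (k + 1)) : expR K = k + 1 := by
  have := Fact.mk hp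
  rw [expR, primeP_eq hp hc, hc, padicValNat.prime_pow]

/-- The numerical invariants of a field of conductor `p ^ (k + 1)`, the covering bound for its ring
of integers and the lower bound for its discriminant. -/
lemma exists_invariants {K : Type u} [Field K] [NumberField K] (hK : IsAbelianOddPrimePower K) :
    ∃ p k : ℕ, p.Prime ∧ 3 ≤ p ∧ primeP K = p ∧ expR K = k + 1 ∧ 1 ≤ codegreeE K ∧
      codegreeE K ≤ p - 1 ∧ degreeN K * codegreeE K = p ^ k * (p - 1) ∧
      (∀ x : K, ∃ c : 𝓞 K, |((Algebra.norm ℚ (x - (c : K)) : ℚ) : ℝ)| ^ (2 * codegreeE K) ≤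
        (((p : ℝ) ^ (k + 2) + (p : ℝ) ^ (k + 1) + 1 - (codegreeE K : ℝ) ^ 2) / (12 * p)) ^
          (p ^ k * (p - 1))) ∧
      p ^ (p ^ k * ((p - 1) * (k + 1) - 1)) ≤ p ^ (codegreeE K - 1) * absDiscr K ^ codegreeE K := by
  obtain ⟨p, r, hp, hodd, hr, hc⟩ := hK.conductor_eq
  obtain ⟨k, rfl⟩ : ∃ k, r = k + 1 := ⟨r - 1, by omega⟩
  have := Fact.mk hp
  obtain ⟨f, hf⟩ := exists_ringHom_codegreeE_eq hc (NeZero.ne _)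
  set L := CyclotomicField (p ^ (k + 1)) ℚ
  have : IsCyclotomicExtension {p ^ (k + 1)} ℚ L :=
    CyclotomicField.isCyclotomicExtension (p ^ (k + 1)) ℚ
  have : NumberField L := IsCyclotomicExtension.numberField {p ^ (k + 1)} ℚ L
  let : Algebra K L := f.toAlgebra
  have he : codegreeE K = Module.finrank K L := hf.trans finrank_fieldRange
  have hdvd : ¬ p ∣ Module.finrank K L := by
    intro h
    have h1 : p ^ k ∈ {m : ℕ | 0 < m ∧ Nonempty (K →+* CyclotomicField m ℚ)} :=
      ⟨pow_pos hp.pos k, nonempty_ringHom_of_dvd_finrank hodd h⟩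
    have h2 := Nat.sInf_le h1
    rw [← conductor, hc] at h2
    exact absurd h2 (not_le.2 (Nat.pow_lt_pow_right hp.one_lt k.lt_succ_self))
  have hp2 := hp.two_le
  have hp3 : 3 ≤ p := by
    rcases hodd with ⟨j, rfl⟩; omega
  have hn := finrank_mul_finrank_of_cyclotomic K L p k
  refine ⟨p, k, hp, hp3, primeP_eq hp hc, expR_eq hp hc, ?_, ?_, ?_, ?_, ?_⟩
  · rw [he]; exact Module.finrank_pos
  · rw [he]; exact Nat.le_of_dvd (by omega) (finrank_dvd_sub_one k hdvd)
  · rw [he]; exact hn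
  · intro x
    obtain ⟨ζ, hζ⟩ := IsCyclotomicExtension.exists_isPrimitiveRoot ℚ L
      (Set.mem_singleton (p ^ (k + 1))) (NeZero.ne _)
    obtain ⟨c, hcx⟩ := exists_sum_embeddings_norm_sq_le hζ hdvd x
    refine ⟨c, ?_⟩
    have h1 := abs_norm_sq_le (algebraMap K L (x - c))
    have hN : (0 : ℝ) < Module.finrank ℚ L := by exact_mod_cast Module.finrank_pos
    rw [abs_norm_pow_finrank, ← pow_mul, mul_comm _ 2] at h1
    rw [he]
    refine h1.trans ?_
    have hL : Module.finrank ℚ L = p ^ k * (p - 1) := by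
      rw [← hn, Module.finrank_mul_finrank]
    have hLr : (Module.finrank ℚ L : ℝ) = (p : ℝ) ^ k * (p - 1) := by
      rw [hL, Nat.cast_mul, Nat.cast_pow, Nat.cast_pred hp.pos]
    rw [← hL]
    refine pow_le_pow_left₀ (by positivity) ?_ _
    rw [div_le_iff₀ hN, mul_comm, hLr]
    exact hcx
  · rw [he]
    refine le_trans (le_of_eq ?_) (natAbs_discr_le_of_tame (k := k) hdvd)
    rw [IsCyclotomicExtension.Rat.discr_prime_pow_succ p k L]
    simp [Int.natAbs_mul, Int.natAbs_pow]

/-- The `2e`-th power of the target inequality. The factor `√p ^ E` supplies exactly `p ^ (p ^ k + e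
- 1)`: the part `p ^ k` is what `D_L` lacks from `p ^ ((k + 1) * n * e)`, and `e - 1` comes from the
different. -/
lemma pow_le_of_discr_bound {p k n e D : ℕ} {B A E : ℝ} (hp : 3 ≤ p) (he : 1 ≤ e)
    (hn : n * e = p ^ k * (p - 1)) (hA : 0 ≤ A) (hB : B = A * (p : ℝ) ^ (k + 1))
    (hE : E * (n * e : ℕ) = (p : ℝ) ^ k - 1 + e)
    (hD : p ^ (p ^ k * ((p - 1) * (k + 1) - 1)) ≤ p ^ (e - 1) * D ^ e) :
    B ^ (p ^ k * (p - 1)) ≤ ((√A * √(p : ℝ) ^ E) ^ n * √(D : ℝ)) ^ (2 * e) := by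
  have hp0 : (0 : ℝ) < p := by positivity
  have h1 : p ^ ((k + 1) * (p ^ k * (p - 1))) ≤ p ^ (p ^ k + (e - 1)) * D ^ e := by
    have e1 : (k + 1) * (p ^ k * (p - 1)) = p ^ k + p ^ k * ((p - 1) * (k + 1) - 1) := by
      obtain ⟨q, hq⟩ : ∃ q, (p - 1) * (k + 1) = q + 1 :=
        ⟨(p - 1) * (k + 1) - 1, by
          have : 0 < (p - 1) * (k + 1) := Nat.mul_pos (by omega) (by omega)
          omega⟩
      have : (k + 1) * (p ^ k * (p - 1)) = p ^ k * ((p - 1) * (k + 1)) := by ring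
      rw [this, hq, Nat.add_sub_cancel]
      ring
    rw [e1, pow_add, pow_add, mul_assoc]
    exact Nat.mul_le_mul_left _ hD
  have h2 : (p : ℝ) ^ ((k + 1) * (p ^ k * (p - 1))) ≤ (p : ℝ) ^ (p ^ k + (e - 1)) * (D : ℝ) ^ e := by
    exact_mod_cast h1
  have h3 : (√(p : ℝ) ^ E) ^ (2 * (n * e)) = (p : ℝ) ^ (p ^ k + (e - 1)) := by
    rw [← Real.rpow_natCast, ← Real.rpow_mul (Real.sqrt_nonneg _), Real.sqrt_eq_rpow,
      ← Real.rpow_mul hp0.le, ← Real.rpow_natCast (p : ℝ)]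
    congr 1
    push_cast [Nat.cast_pred (show 0 < e from he)] at hE ⊢
    linear_combination hE
  have h4 : √A ^ (2 * (n * e)) = A ^ (n * e) := by rw [pow_mul, Real.sq_sqrt hA]
  have h5 : √(D : ℝ) ^ (2 * e) = (D : ℝ) ^ e := by rw [pow_mul, Real.sq_sqrt (by positivity)]
  calc B ^ (p ^ k * (p - 1)) = A ^ (n * e) * (p : ℝ) ^ ((k + 1) * (p ^ k * (p - 1))) := by
        rw [hB, mul_pow, ← pow_mul, hn]
    _ ≤ A ^ (n * e) * ((p : ℝ) ^ (p ^ k + (e - 1)) * (D : ℝ) ^ e) := by gcongr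
    _ = _ := by
        rw [mul_pow, ← pow_mul, h5, show n * (2 * e) = 2 * (n * e) by ring, mul_pow, h3, h4]
        ring

/-- The Euclidean minimum bound. -/
theorem euclideanMinimum_le (K : Type u) [Field K] [NumberField K]
    (hK : IsAbelianOddPrimePower K) :
    euclideanMinimum K ≤ ENNReal.ofReal (omega K ^ degreeN K * √(absDiscr K : ℝ)) := by
  obtain ⟨p, k, hp, hp3, hpK, hrK, he1, hep, hn, hN, hD⟩ := exists_invariants hK
  refine iSup_le fun x => ?_
  obtain ⟨c, hc⟩ := hN x
  refine (iInf_le _ c).trans (ENNReal.ofReal_le_ofReal ?_)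
  have hp0 : (0 : ℝ) < p := by exact_mod_cast hp.pos
  have he0 : 2 * codegreeE K ≠ 0 := by omega
  -- The exponent `2e` arises as `N_L = N_K ^ e` on `K` and AM-GM bounds the square of `N_L`.
  rw [← pow_le_pow_iff_left₀ (abs_nonneg _) (by unfold omega constC; positivity) he0]
  refine hc.trans ?_
  rw [omega, constC, constDelta, hpK, hrK, exponent_eq (by omega) he1 hn, Nat.add_sub_cancel]
  -- Keeps the radicand of `C(K)` nonnegative, so that squaring the root recovers it.
  have hsq : codegreeE K ^ 2 ≤ p ^ (k + 2) := by
    calc codegreeE K ^ 2 ≤ p ^ 2 := Nat.pow_le_pow_left (by omega) 2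
      _ ≤ p ^ (k + 2) := Nat.pow_le_pow_right hp.pos (by omega)
  have hsq' : (codegreeE K : ℝ) ^ 2 ≤ (p : ℝ) ^ (k + 2) := by exact_mod_cast hsq
  have hpk : 0 < (p : ℝ) ^ (k + 1) := by positivity
  refine pow_le_of_discr_bound hp3 he1 hn (div_nonneg ?_ (by positivity)) ?_ ?_ hD
  · rw [show k + 1 + 1 = k + 2 from rfl]; linarith
  · rw [show k + 1 + 1 = k + 2 from rfl, pow_succ (p : ℝ) (k + 1)]
    field_simp
  · have h3 : (3 : ℝ) ≤ p := by exact_mod_cast hp3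
    have : (p : ℝ) - 1 ≠ 0 := by linarith
    rw [hn, Nat.cast_mul, Nat.cast_pow, Nat.cast_pred hp.pos]
    field_simp

/-- Uniform two-sided bounds for `omega`. -/
lemma omega_bounds {K : Type u} [Field K] [NumberField K] (hK : IsAbelianOddPrimePower K) {c : ℝ}
    (he : codegreeE K ^ 2 ≤ primeP K ^ expR K + 1)
    (hE : ((primeP K : ℝ) ^ (expR K - 1) - 1 + codegreeE K) /
      ((primeP K : ℝ) ^ (expR K - 1) * ((primeP K : ℝ) - 1)) ≤ c / primeP K) :
    1 / (2 * √3) ≤ omega K ∧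
      omega K ≤ √((1 + 1 / (primeP K : ℝ)) / 12) * √(primeP K : ℝ) ^ (c / primeP K) := by
  obtain ⟨p, k, hp, hp3, hpK, hrK, he1, hep, hn, hN, hD⟩ := exists_invariants hK
  rw [hpK, hrK] at hE he
  rw [hpK]
  rw [omega, constC, constDelta, hpK, hrK, exponent_eq (by omega) he1 hn]
  exact sqrt_mul_rpow_bounds hp.pos he1 he (exponent_nonneg (by omega)) hE

lemma omega_bounds_of_two_le {K : Type u} [Field K] [NumberField K]
    (hK : IsAbelianOddPrimePower K) (hr : 2 ≤ expR K) :
    1 / (2 * √3) ≤ omega K ∧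
      omega K ≤ √((1 + 1 / (primeP K : ℝ)) / 12) * √(primeP K : ℝ) ^ (2 / (primeP K : ℝ)) := by
  refine omega_bounds hK ?_ ?_ <;>
    obtain ⟨p, k, hp, hp3, hpK, hrK, he1, hep, hn, hN, hD⟩ := exists_invariants hK
  · rw [hpK]
    calc codegreeE K ^ 2 ≤ p ^ 2 := Nat.pow_le_pow_left (by omega) 2
      _ ≤ p ^ expR K := Nat.pow_le_pow_right hp.pos hr
      _ ≤ _ := Nat.le_succ _
  · rw [hpK]
    exact exponent_le_two_div (by omega) hep hr

lemma omega_bounds_of_eq_one {K : Type u} [Field K] [NumberField K]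
    (hK : IsAbelianOddPrimePower K) (hr : expR K = 1) (he : codegreeE K ^ 2 ≤ primeP K) :
    1 / (2 * √3) ≤ omega K ∧
      omega K ≤ √((1 + 1 / (primeP K : ℝ)) / 12) *
        √(primeP K : ℝ) ^ ((2 * codegreeE K : ℝ) / (primeP K : ℝ)) := by
  refine omega_bounds hK ?_ ?_
  · rw [hr, pow_one]; omega
  · obtain ⟨p, k, hp, hp3, hpK, -⟩ := exists_invariants hK
    rw [hr, hpK]
    exact exponent_le_of_eq_one (by omega)

lemma hasLimitAsP_of_bounds {D : ∀ (K : Type u) [Field K] [NumberField K], Prop} (c N₀ : ℝ)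
    (h : ∀ (K : Type u) [Field K] [NumberField K], IsAbelianOddPrimePower K → D K →
      N₀ ≤ (primeP K : ℝ) → 1 / (2 * √3) ≤ omega K ∧
        omega K ≤ √((1 + 1 / (primeP K : ℝ)) / 12) * √(primeP K : ℝ) ^ (c / (primeP K : ℝ))) :
    HasLimitAsP.{u} D (fun K _ _ => omega K) (1 / (2 * √3)) := by
  intro ε hε
  have h1 := (tendsto_sqrt_mul_sqrt_rpow c).eventually (gt_mem_nhds (lt_add_of_pos_right _ hε))
  obtain ⟨N, hN⟩ := Filter.eventually_atTop.1 h1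
  refine ⟨max 1 (max N₀ N), by positivity, fun K _ _ hK hD hp => ?_⟩
  have hp1 : N₀ ≤ (primeP K : ℝ) := ((le_max_left _ _).trans (le_max_right _ _)).trans hp.le
  have hp2 : N ≤ (primeP K : ℝ) := ((le_max_right _ _).trans (le_max_right _ _)).trans hp.le
  obtain ⟨h2, h3⟩ := h K hK hD hp1
  have h4 := hN _ hp2
  rw [abs_lt]
  constructor <;> linarith

end Main

end

end AbelianEuclidean

theorem mainTheorem2 :
    (∀ (K : Type u) [Field K] [NumberField K], AbelianEuclidean.IsAbelianOddPrimePower K →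
      AbelianEuclidean.euclideanMinimum K ≤
        ENNReal.ofReal (AbelianEuclidean.omega K ^ AbelianEuclidean.degreeN K *
          Real.sqrt (AbelianEuclidean.absDiscr K : ℝ))) ∧
    AbelianEuclidean.HasLimitAsP.{u} (fun K _ _ => 2 ≤ AbelianEuclidean.expR K)
      (fun K _ _ => AbelianEuclidean.omega K) (1 / (2 * Real.sqrt 3)) ∧
    (∀ e₀ : ℕ, AbelianEuclidean.HasLimitAsP.{u}
      (fun K _ _ => AbelianEuclidean.expR K = 1 ∧ AbelianEuclidean.codegreeE K = e₀)
      (fun K _ _ => AbelianEuclidean.omega K) (1 / (2 * Real.sqrt 3))) ∧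
    (∀ (K : Type u) [Field K] [NumberField K], AbelianEuclidean.IsAbelianOddPrimePower K →
      2 ≤ AbelianEuclidean.expR K →
      AbelianEuclidean.omega K ≤ (3 : ℝ) ^ (-(2 / 3) : ℝ)) := by
  refine ⟨AbelianEuclidean.euclideanMinimum_le,
    AbelianEuclidean.hasLimitAsP_of_bounds 2 0 fun K _ _ hK hr _ =>
      AbelianEuclidean.omega_bounds_of_two_le hK hr,
    -- For `r = 1`, the condition `p ≥ e₀²` ensures `C(K)² ≥ 1/12`, and `e₀ / (p - 1) ≤ 2 * e₀ / p`.
    fun e₀ => AbelianEuclidean.hasLimitAsP_of_bounds (2 * e₀) (e₀ ^ 2) fun K _ _ hK hD hp => ?_,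
    fun K _ _ hK hr => (AbelianEuclidean.omega_bounds_of_two_le hK hr).2.trans ?_⟩
  · obtain ⟨hr, rfl⟩ := hD
    exact AbelianEuclidean.omega_bounds_of_eq_one hK hr (by exact_mod_cast hp)
  · obtain ⟨p, k, hp, hp3, hpK, -⟩ := AbelianEuclidean.exists_invariants hK
    rw [hpK]
    exact AbelianEuclidean.sqrt_mul_sqrt_rpow_le hp3
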